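/- Let $M$ be a smooth $n$-dimensional manifold, $E=TM\setminus 0$ its slit tangent bundle, $\pi\colon E\to M$ the projection. Let $g$ be a metric on the pullback tangent bundle $\pi^*(TM)\to E$, i.e. a $C^\infty$, symmetric, non-degenerate section of $\pi^*(T^*M\otimes T^*M)$, of any signature. A \emph{Finsler connection} is a smooth Koszul connection $\nabla$ on $\pi^*(TM)\to E$; $D$ denotes its covariant exterior differential on tensor-valued forms on $E$. Let $y$ be the Liouville section of $\pi^*(TM)$ (the value at $X\in E$ is $X$), $\omega=\pi_*$ the canonical $TM$-valued $1$-form on $E$, and $T=D\omega$. Call $\nabla$ \emph{regular} if, at every point of $E$, the map $Z\mapsto\nabla_Z y$ is injective on the vertical space $\ker\pi_*$. Consider the conditions (α) $\nabla$ is regular; (β) $T=0$; (γ) $y\cdot Dg=0$, i.e. $(\nabla_Xg)(y,v)=0$ for all $X,v$; (δ) $Dg\wedge Dy=0$, i.e. $(\nabla_Xg)(u,\nabla_Yy)-(\nabla_Yg)(u,\nabla_Xy)=0$ for all $X,Y,u$. Then: 1. There is at most one Finsler connection satisfying (α)–(δ). 2. If a Finsler connection $\nabla$ satisfies (α)–(δ),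 then there is a $C^\infty$ function $\mathscr L\colon E\to\mathbb R$ with $\mathscr L(sy)=s^2\mathscr L(y)$ for all $s>0$, such that $g$ is the vertical Hessian of $\mathscr L$, $g_y(u,v)=\frac{\partial^2}{\partial r\,\partial s}\mathscr L(y+ru+sv)\big|_{r=s=0}$, and $\nabla$ is the Chern connection of $\mathscr L$: in the coordinates $(x^a,y^a)$ induced by any chart of $M$, with $e_a=\partial/\partial x^a$, one has $\nabla e_b=\Gamma^a{}_{bc}\,dx^c\otimes e_a$, where $$\Gamma^a{}_{bc}=\tfrac12 g^{ad}\Big(\tfrac{\delta g_{dc}}{\delta x^b}+\tfrac{\delta g_{db}}{\delta x^c}-\tfrac{\delta g_{bc}}{\delta x^d}\Big),\quad \tfrac{\delta}{\delta x^c}=\tfrac{\partial}{\partial x^c}-N^b_c\tfrac{\partial}{\partial y^b},\quad N^a_c=\tfrac{\partial G^a}{\partial y^c},\quad 2G^a=g^{ad}\Big(\tfrac{\partial^2\mathscr L}{\partial x^c\partial y^d}y^c-\tfrac{\partial\mathscr L}{\partial x^d}\Big).$$ 3. Conversely, if $g$ is the vertical Hessian of a $C^\infty$ function $\mathscr L\colon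 E\to\mathbb R$ that is positively homogeneous of degree two, then a Finsler connection satisfying (α)–(δ) exists (and so, by 1, it is unique). Statements 1–3 remain true if (δ) is replaced throughout by (δ') $y\cdot D^2g=0$, i.e. $(D(Dg))(X,Y)(y,v)=0$ for all $X,Y,v$. -/

import Mathlib

noncomputable section

namespace FinslerGeometry

open Bundle
open scoped Manifold ContDiff

/-! ### The slit tangent bundle and the pullback tangent bundle -/

section Bundles

variable (n : ℕ) (M : Type*) [TopologicalSpace M] [ChartedSpace (EuclideanSpace ℝ (Fin n)) M]
  [IsManifold (𝓡 n) ∞ M]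

theorem isOpen_slit : IsOpen {p : TangentBundle (𝓡 n) M | p.2 ≠ 0} := by
  rw [isOpen_iff_mem_nhds]
  intro p hp
  let e := trivializationAt (EuclideanSpace ℝ (Fin n)) (TangentSpace (𝓡 n) : M → Type) p.1
  have key : ∀ q : TangentBundle (𝓡 n) M, q ∈ e.source → ((e q).2 = 0 ↔ q.2 = 0) := by
    intro q hq
    have hq' : q.1 ∈ e.baseSet := e.mem_source.1 hq
    have h : e.continuousLinearEquivAt ℝ q.1 hq' q.2 = (e q).2 :=
      congrFun (e.continuousLinearEquivAt_apply ℝ q.1 hq') q.2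
    rw [← h]
    exact (e.continuousLinearEquivAt ℝ q.1 hq').map_eq_zero_iff
  have hps : p ∈ e.source :=
    e.mem_source.2 (FiberBundle.mem_baseSet_trivializationAt' p.1)
  have hc : ContinuousAt (fun q => (e q).2) p :=
    (e.continuousOn.continuousAt (e.open_source.mem_nhds hps)).snd
  have h1 : ∀ᶠ q in nhds p, (e q).2 ≠ 0 :=
    hc.eventually_ne (fun h => hp ((key p hps).1 h))
  filter_upwards [h1, e.open_source.mem_nhds hps] with q h2 h3
  exact fun h => h2 ((key q h3).2 h)

/-- The slit tangent bundle `E = TM \ 0`, an open submanifold of `TM`. -/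
def slit : TopologicalSpace.Opens (TangentBundle (𝓡 n) M) :=
  ⟨{p | p.2 ≠ 0}, isOpen_slit n M⟩

/-- The vector space on which the manifold `E = TM \ 0` is modelled; its elements are the
coordinates `(x, y)`. -/
abbrev ModelE : Type := EuclideanSpace ℝ (Fin n) × EuclideanSpace ℝ (Fin n)

/-- The model with corners of the manifold `E = TM \ 0`. -/
abbrev IE : ModelWithCorners ℝ (ModelE n)
    (ModelProd (EuclideanSpace ℝ (Fin n)) (EuclideanSpace ℝ (Fin n))) := (𝓡 n).tangent

/-- The projection `π : E → M`. -/
def proj : ContMDiffMap (IE n) (𝓡 n) (slit n M) M ∞ :=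
  ⟨fun p => p.1.1, (contMDiff_proj (TangentSpace (𝓡 n) : M → Type)).comp contMDiff_subtype_val⟩

/-- The pullback tangent bundle `π^*(TM) → E`; its fibre at `p` is `T_{π(p)} M`. -/
abbrev PTM : slit n M → Type := (proj n M) *ᵖ (TangentSpace (𝓡 n) : M → Type)

instance (p : slit n M) : AddCommGroup (PTM n M p) :=
  { (inferInstance : AddCommMonoid (PTM n M p)) with
    neg := Neg.neg (α := TangentSpace (𝓡 n) (p.1.1 : M))
    sub := Sub.sub (α := TangentSpace (𝓡 n) (p.1.1 : M))
    sub_eq_add_neg := sub_eq_add_neg (G := TangentSpace (𝓡 n) (p.1.1 : M))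
    zsmul := (inferInstance : AddCommGroup (TangentSpace (𝓡 n) (p.1.1 : M))).zsmul
    zsmul_zero' := (inferInstance : AddCommGroup (TangentSpace (𝓡 n) (p.1.1 : M))).zsmul_zero'
    zsmul_succ' := (inferInstance : AddCommGroup (TangentSpace (𝓡 n) (p.1.1 : M))).zsmul_succ'
    zsmul_neg' := (inferInstance : AddCommGroup (TangentSpace (𝓡 n) (p.1.1 : M))).zsmul_neg'
    neg_add_cancel := neg_add_cancel (G := TangentSpace (𝓡 n) (p.1.1 : M)) }

instance (p : slit n M) : IsTopologicalAddGroup (PTM n M p) :=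
  inferInstanceAs (IsTopologicalAddGroup (TangentSpace (𝓡 n) (p.1.1 : M)))

instance (p : slit n M) : ContinuousSMul ℝ (PTM n M p) :=
  inferInstanceAs (ContinuousSMul ℝ (TangentSpace (𝓡 n) (p.1.1 : M)))

/-- Vector fields on `E` (no regularity is imposed). -/
abbrev VecField : Type _ := Π p : slit n M, TangentSpace (IE n) p

/-- Sections of `π^*(TM) → E` (no regularity is imposed). -/
abbrev Sec : Type _ := Π p : slit n M, PTM n M p

end Bundles

variable {n : ℕ} {M : Type*} [TopologicalSpace M] [ChartedSpace (EuclideanSpace ℝ (Fin n)) M]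
  [IsManifold (𝓡 n) ∞ M]

/-- The vector field `X` is `C^∞` on `U`. -/
def SmoothFieldOn (U : Set (slit n M)) (X : VecField n M) : Prop :=
  ContMDiffOn (IE n) (IE n).tangent ∞
    (fun p => (⟨p, X p⟩ : TangentBundle (IE n) (slit n M))) U

/-- The section `u` of `π^*(TM)` is `C^∞` on `U`. -/
def SmoothSecOn (U : Set (slit n M)) (u : Sec n M) : Prop :=
  ContMDiffOn (IE n) ((IE n).prod (𝓡 n)) ∞
    (fun p => TotalSpace.mk' (EuclideanSpace ℝ (Fin n)) p (u p)) U

/-! ### Metrics and Finsler connections -/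

variable (n M) in
/-- A (pseudo-)metric on the pullback tangent bundle: a `C^∞` section of `π^*(T^*M ⊗ T^*M)` that is
symmetric and non-degenerate. -/
structure PullbackMetric where
  /-- the bilinear form on the fibre over `p` -/
  toFun : Π p : slit n M, PTM n M p →L[ℝ] PTM n M p →L[ℝ] ℝ
  symm : ∀ p u v, toFun p u v = toFun p v u
  nondegenerate : ∀ p u, (∀ v, toFun p u v = 0) → u = 0
  smooth : ContMDiff (IE n)
    ((IE n).prod 𝓘(ℝ, EuclideanSpace ℝ (Fin n) →L[ℝ] EuclideanSpace ℝ (Fin n) →L[ℝ] ℝ)) ∞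
    (fun p => TotalSpace.mk'
      (EuclideanSpace ℝ (Fin n) →L[ℝ] EuclideanSpace ℝ (Fin n) →L[ℝ] ℝ) p (toFun p))

variable (n M) in
/-- A Finsler connection: a Koszul connection `∇` on `π^*(TM) → E` which is `C^∞`, i.e. `∇ u` is
`C^∞` on every open set on which `u` is `C^∞`. -/
structure FinslerConnection where
  /-- the underlying covariant derivative -/
  cov : CovariantDerivative (IE n) (EuclideanSpace ℝ (Fin n)) (PTM n M)
  smooth : ∀ U : Set (slit n M), IsOpen U →
    ContMDiffCovariantDerivativeOn (EuclideanSpace ℝ (Fin n)) ∞ cov.toFun U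

/-- `∇_X u`. -/
def FinslerConnection.nabla (D : FinslerConnection n M) (X : VecField n M) (u : Sec n M) : Sec n M :=
  fun p => D.cov u p (X p)

/-- Two Finsler connections are the same when they agree on all differentiable sections
(their values on other sections are meaningless). -/
def FinslerConnection.Same (D D' : FinslerConnection n M) : Prop :=
  ∀ (u : Sec n M) (p : slit n M),
    MDifferentiableAt (IE n) ((IE n).prod (𝓡 n))
      (fun q => TotalSpace.mk' (EuclideanSpace ℝ (Fin n)) q (u q)) p →
    D.cov u p = D'.cov u p

/-- The Liouville section `y` of `π^*(TM)`, whose value at `p ∈ E` is `p` itself. -/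
def liouville : Sec n M := fun p => p.1.2

/-- The `TM`-valued `1`-form `ω = π_*` on `E`. -/
def omega (p : slit n M) : TangentSpace (IE n) p →L[ℝ] PTM n M p :=
  mfderiv (IE n) (𝓡 n) (proj n M) p

/-- Regularity: `Z ↦ ∇_Z y` is injective on the vertical spaces `V_p E = ker π_*`. -/
def FinslerConnection.IsRegular (D : FinslerConnection n M) : Prop :=
  ∀ (p : slit n M) (Z : TangentSpace (IE n) p),
    omega p Z = 0 → D.cov liouville p Z = 0 → Z = 0

/-! ### The covariant exterior differential -/

/-- `(Dθ)(X, Y) = ∇_X (θ(Y)) - ∇_Y (θ(X)) - θ([X, Y])` for a `TM`-valued `1`-form `θ` on `E`. -/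
def FinslerConnection.extDerivVec (D : FinslerConnection n M)
    (θ : Π p : slit n M, TangentSpace (IE n) p →L[ℝ] PTM n M p) (X Y : VecField n M) : Sec n M :=
  fun p => D.nabla X (fun q => θ q (Y q)) p - D.nabla Y (fun q => θ q (X q)) p
    - θ p (VectorField.mlieBracket (IE n) X Y p)

/-- The horizontal torsion `T = Dω`. -/
def FinslerConnection.torsion (D : FinslerConnection n M) (X Y : VecField n M) : Sec n M :=
  D.extDerivVec omega X Y

/-- `(∇_X h)(u, v) = X(h(u, v)) - h(∇_X u, v) - h(u, ∇_X v)` for a bilinear form `h` on `π^*(TM)`,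
given through its action on sections. -/
def FinslerConnection.nablaBilin (D : FinslerConnection n M) (X : VecField n M)
    (h : Sec n M → Sec n M → slit n M → ℝ) (u v : Sec n M) : slit n M → ℝ :=
  fun p => mvfderiv (IE n) (h u v) p (X p) - h (D.nabla X u) v p - h u (D.nabla X v) p

/-- `Dg`, the `1`-form on `E` with values in bilinear forms: `Dg(X)(u, v) = (∇_X g)(u, v)`. -/
def FinslerConnection.Dg (D : FinslerConnection n M) (g : PullbackMetric n M) (X : VecField n M) :
    Sec n M → Sec n M → slit n M → ℝ :=
  D.nablaBilin X (fun u v p => g.toFun p (u p) (v p))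

/-- `(Dθ)(X, Y) = ∇_X (θ(Y)) - ∇_Y (θ(X)) - θ([X, Y])` for a `1`-form `θ` on `E` with values in
bilinear forms on `π^*(TM)`. -/
def FinslerConnection.extDerivBilin (D : FinslerConnection n M)
    (θ : VecField n M → Sec n M → Sec n M → slit n M → ℝ) (X Y : VecField n M) (u v : Sec n M) :
    slit n M → ℝ :=
  fun p => D.nablaBilin X (θ Y) u v p - D.nablaBilin Y (θ X) u v p
    - θ (VectorField.mlieBracket (IE n) X Y) u v p

/-- `D²g = D(Dg)`, a `2`-form on `E` with values in bilinear forms on `π^*(TM)`. -/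
def FinslerConnection.DDg (D : FinslerConnection n M) (g : PullbackMetric n M) (X Y : VecField n M)
    (u v : Sec n M) : slit n M → ℝ :=
  D.extDerivBilin (D.Dg g) X Y u v

/-- `(Dg ∧ Dy)(X, Y)(u) = Dg(X)(u, ∇_Y y) - Dg(Y)(u, ∇_X y)`: wedge product of the form parts,
together with the contraction of the last index of `Dg` with the index of `Dy`. -/
def FinslerConnection.DgWedgeDy (D : FinslerConnection n M) (g : PullbackMetric n M) (X Y : VecField n M)
    (u : Sec n M) : slit n M → ℝ :=
  fun p => D.Dg g X u (D.nabla Y liouville) p - D.Dg g Y u (D.nabla X liouville) p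

/-- `T = 0`. -/
def FinslerConnection.TorsionFree (D : FinslerConnection n M) : Prop :=
  ∀ U : Set (slit n M), IsOpen U → ∀ X Y : VecField n M, SmoothFieldOn U X → SmoothFieldOn U Y →
    ∀ p ∈ U, D.torsion X Y p = 0

/-- `y · Dg = 0`. -/
def FinslerConnection.YDgZero (D : FinslerConnection n M) (g : PullbackMetric n M) : Prop :=
  ∀ U : Set (slit n M), IsOpen U → ∀ (X : VecField n M) (v : Sec n M),
    SmoothFieldOn U X → SmoothSecOn U v → ∀ p ∈ U, D.Dg g X liouville v p = 0

/-- `Dg ∧ Dy = 0`. -/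
def FinslerConnection.DgWedgeDyZero (D : FinslerConnection n M) (g : PullbackMetric n M) : Prop :=
  ∀ U : Set (slit n M), IsOpen U → ∀ (X Y : VecField n M) (u : Sec n M),
    SmoothFieldOn U X → SmoothFieldOn U Y → SmoothSecOn U u → ∀ p ∈ U, D.DgWedgeDy g X Y u p = 0

/-- `y · D²g = 0`. -/
def FinslerConnection.YDDgZero (D : FinslerConnection n M) (g : PullbackMetric n M) : Prop :=
  ∀ U : Set (slit n M), IsOpen U → ∀ (X Y : VecField n M) (v : Sec n M),
    SmoothFieldOn U X → SmoothFieldOn U Y → SmoothSecOn U v → ∀ p ∈ U, D.DDg g X Y liouville v p = 0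

/-! ### Finsler Lagrangians -/

/-- `L` is `C^∞` on `E` and positively homogeneous of degree two. `L` stands for a function on
`E = TM \ 0`: its values on the zero section are irrelevant. -/
structure IsLagrangian (L : TangentBundle (𝓡 n) M → ℝ) : Prop where
  smooth : ContMDiffOn (IE n) 𝓘(ℝ, ℝ) ∞ L {p : TangentBundle (𝓡 n) M | p.2 ≠ 0}
  homogeneous : ∀ (x : M) (y : TangentSpace (𝓡 n) x), y ≠ 0 → ∀ s : ℝ, 0 < s →
    L ⟨x, s • y⟩ = s ^ 2 * L ⟨x, y⟩

/-- `g` is the vertical Hessian of `L`: `g_y(u, v) = ∂²/∂r∂s L(y + r u + s v)` at `r = s = 0`. -/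
def IsVerticalHessian (g : PullbackMetric n M) (L : TangentBundle (𝓡 n) M → ℝ) : Prop :=
  ∀ (p : slit n M) (u v : TangentSpace (𝓡 n) (p.1.1 : M)),
    g.toFun p u v =
      deriv (fun r : ℝ => deriv (fun s : ℝ => L ⟨p.1.1, p.1.2 + r • u + s • v⟩) 0) 0

/-! ### The Chern connection in local coordinates -/

/-- `∂f/∂x^c` for a function `f(x, y)`. -/
def pdx (c : Fin n) (f : ModelE n → ℝ) (z : ModelE n) : ℝ :=
  fderiv ℝ f z (EuclideanSpace.single c 1, 0)

/-- `∂f/∂y^c` for a function `f(x, y)`. -/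
def pdy (c : Fin n) (f : ModelE n → ℝ) (z : ModelE n) : ℝ :=
  fderiv ℝ f z (0, EuclideanSpace.single c 1)

/-- `g_{ab} = ∂²ℓ/∂y^a∂y^b`. -/
def gLow (l : ModelE n → ℝ) (a b : Fin n) (z : ModelE n) : ℝ := pdy a (pdy b l) z

/-- `g^{ab}`, the inverse of the matrix `g_{ab}`. -/
def gUp (l : ModelE n → ℝ) (a b : Fin n) (z : ModelE n) : ℝ :=
  (Matrix.of fun i j => gLow l i j z)⁻¹ a b

/-- The spray coefficients, `2 G^a = g^{ad} (∂²ℓ/∂x^c∂y^d y^c - ∂ℓ/∂x^d)`. -/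
def spray (l : ModelE n → ℝ) (a : Fin n) (z : ModelE n) : ℝ :=
  (1 / 2) * ∑ d, gUp l a d z * (∑ c, pdx c (pdy d l) z * z.2 c - pdx d l z)

/-- The coefficients `N^a_c = ∂G^a/∂y^c` of Barthel's non-linear connection. -/
def barthel (l : ModelE n → ℝ) (a c : Fin n) (z : ModelE n) : ℝ := pdy c (spray l a) z

/-- `δf/δx^c = ∂f/∂x^c - N^b_c ∂f/∂y^b`. -/
def delta (l : ModelE n → ℝ) (c : Fin n) (f : ModelE n → ℝ) (z : ModelE n) : ℝ :=
  pdx c f z - ∑ b, barthel l b c z * pdy b f z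

/-- `Γ^a_{bc} = ½ g^{ad} (δg_{dc}/δx^b + δg_{db}/δx^c - δg_{bc}/δx^d)`. -/
def chernGamma (l : ModelE n → ℝ) (a b c : Fin n) (z : ModelE n) : ℝ :=
  (1 / 2) * ∑ d, gUp l a d z *
    (delta l b (gLow l d c) z + delta l c (gLow l d b) z - delta l d (gLow l b c) z)

/-- `L` written in the coordinates `(x, y)` of `TM` induced by a chart `φ` of `M`. -/
def inCoords (φ : OpenPartialHomeomorph M (EuclideanSpace ℝ (Fin n)))
    (L : TangentBundle (𝓡 n) M → ℝ) (z : ModelE n) : ℝ :=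
  L (tangentMap (𝓡 n) (𝓡 n) φ.symm ⟨z.1, z.2⟩)

/-- The coordinates `(x, y)` of the point `p ∈ E`. -/
def coords (φ : OpenPartialHomeomorph M (EuclideanSpace ℝ (Fin n))) (p : slit n M) : ModelE n :=
  (φ p.1.1, mfderiv (𝓡 n) (𝓡 n) φ p.1.1 p.1.2)

/-- The coordinate frame `e_b = ∂/∂x^b` as a section of `π^*(TM)` (over the domain of the chart). -/
def frame (φ : OpenPartialHomeomorph M (EuclideanSpace ℝ (Fin n))) (b : Fin n) : Sec n M :=
  fun p => (mfderiv (𝓡 n) (𝓡 n) φ p.1.1).inverse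
    (EuclideanSpace.single b (1 : ℝ) : EuclideanSpace ℝ (Fin n))

/-- The value of `ω^c = π^*(dx^c)` on `Z ∈ T_p E`. -/
def dx (φ : OpenPartialHomeomorph M (EuclideanSpace ℝ (Fin n))) (c : Fin n) (p : slit n M)
    (Z : TangentSpace (IE n) p) : ℝ :=
  (show EuclideanSpace ℝ (Fin n) from mfderiv (𝓡 n) (𝓡 n) φ p.1.1 (omega p Z)) c

/-- `D` is the Chern connection of `L`: in the coordinates induced by any chart of `M`, the
connection forms `ω^a_b = H^a_{bc} ω^c + V^a_{bc} \bar ω^c` have `H^a_{bc} = Γ^a_{bc}` and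
`V^a_{bc} = 0`, that is `∇ e_b = Γ^a_{bc} ω^c ⊗ e_a`. -/
def FinslerConnection.IsChern (D : FinslerConnection n M) (L : TangentBundle (𝓡 n) M → ℝ) : Prop :=
  ∀ φ ∈ IsManifold.maximalAtlas (𝓡 n) ∞ M, ∀ p : slit n M, (p.1.1 : M) ∈ φ.source →
    ∀ (b : Fin n) (Z : TangentSpace (IE n) p),
      D.cov (frame φ b) p Z =
        ∑ a, (∑ c, chernGamma (inCoords φ L) a b c (coords φ p) * dx φ c p Z) • frame φ a p

/-! ### The two systems of axioms -/

/-- Regularity, `T = 0`, `y · Dg = 0`, `Dg ∧ Dy = 0`. -/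
structure FinslerConnection.ChernAxioms (D : FinslerConnection n M) (g : PullbackMetric n M) : Prop where
  regular : D.IsRegular
  torsionFree : D.TorsionFree
  homogeneity : D.YDgZero g
  almostMetric : D.DgWedgeDyZero g

/-- Regularity, `T = 0`, `y · Dg = 0`, `y · D²g = 0`. -/
structure FinslerConnection.ChernAxioms' (D : FinslerConnection n M) (g : PullbackMetric n M) : Prop where
  regular : D.IsRegular
  torsionFree : D.TorsionFree
  homogeneity : D.YDgZero g
  almostMetric : D.YDDgZero g

end FinslerGeometry

end

set_option linter.unusedSectionVars false

noncomputable section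

namespace FinslerGeometry

section

open Filter
open scoped ContDiff Topology

variable {n : ℕ}

/-! ### The vertical Hessian of a function of `(x, y)` -/

/-! Over a chart, `∇` is the flat connection of the coordinate frame plus a connection form. The
equation `T = 0` kills this form in vertical directions and makes the rest symmetric, so that `∇_Z u
= du(Z) + Γ(ω(Z), u)` with `Γ` symmetric (`exists_christoffel`). In particular `∇_Z y` is the vector
that corresponds to `Z` when `Z` is vertical. Put `L = g(y, y) / 2`. Then (γ) with `v = y` gives
`∂_w L = g(y, w)`, and (γ) with a constant `v = u` gives `∂_w ∂_u L = g(w, u)`. Hence `g` is the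
vertical Hessian of `L`, and the first identity at `w = y` is Euler's relation, which integrates
along rays to homogeneity. It follows that the Cartan tensor, the vertical derivative of `g`, is
totally symmetric and annihilated by `y`.

Evaluate (δ) on a horizontal `X`, meaning `∇_X y = 0`, and a vertical `Y`: it says that `∇_X g = 0`.
So `Γ` is symmetric and metric along the horizontal directions `(ξ, -Γ(ξ, y))`, which depend on `Γ`
itself. The circularity is broken by inserting `y` in the Koszul formula. With `y` twice, all Cartan
terms vanish and `Γ(y, y) = 2G`; with `y` once, only `Γ(y, y)` occurs and `Γ(ξ, y) = N(ξ)`; the full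
formula then yields the Chern coefficients (`barthelMap_unique`, `chernMap_unique`). As `L` depends
on `g` alone, this gives uniqueness.

For existence, the Chern coefficients define a connection over each chart. Vanishing torsion and
horizontal metricity do not refer to a chart, so `chernMap_unique` shows that the local connections
agree (`hasChristoffel_chartCov_of_mem`). For this connection `(∇_Z g)(u, v)` is the Cartan tensor
of `∇_Z y, u, v` (`metricDerivComp_chernMap`), from which (γ) and (δ) are read off.

Finally, covariant differentiation of `y · Dg = 0` gives `y · D²g = Dg ∧ Dy` (`dDg_liouville`), so
under (γ) the conditions (δ) and (δ') are equivalent. -/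

/-- The vertical Hessian of a function of `(x, y)`. -/
def vertHess (l : ModelE n → ℝ) (z : ModelE n) :
    EuclideanSpace ℝ (Fin n) →L[ℝ] EuclideanSpace ℝ (Fin n) →L[ℝ] ℝ :=
  ((ContinuousLinearMap.compL ℝ (EuclideanSpace ℝ (Fin n)) (ModelE n) ℝ).flip
    (ContinuousLinearMap.inr ℝ _ _)).comp
      ((fderiv ℝ (fderiv ℝ l) z).comp (ContinuousLinearMap.inr ℝ _ _))

theorem vertHess_apply (l : ModelE n → ℝ) (z : ModelE n) (u v : EuclideanSpace ℝ (Fin n)) :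
    vertHess l z u v = fderiv ℝ (fderiv ℝ l) z (0, u) (0, v) := rfl

/-- Euler's relation for a function of `(x, y)` that is homogeneous of degree two in `y`, with
non-degenerate vertical Hessian, on an open set. -/
structure IsLocalLagrangian (l : ModelE n → ℝ) (W : Set (ModelE n)) : Prop where
  isOpen : IsOpen W
  contDiffOn : ContDiffOn ℝ ∞ l W
  euler : ∀ z ∈ W, fderiv ℝ l z (0, z.2) = 2 * l z
  nondegenerate : ∀ z ∈ W, ∀ u, (∀ v, vertHess l z u v = 0) → u = 0

variable {l : ModelE n → ℝ} {W : Set (ModelE n)} {z : ModelE n}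

theorem sum_single (u : EuclideanSpace ℝ (Fin n)) :
    ∑ i, u i • EuclideanSpace.single i (1 : ℝ) = u := by
  simpa using (EuclideanSpace.basisFun (Fin n) ℝ).sum_repr u

theorem fderiv_fderiv_apply {E F : Type*} [NormedAddCommGroup E] [NormedSpace ℝ E]
    [NormedAddCommGroup F] [NormedSpace ℝ F] {f : E → F} {z : E}
    (hf : DifferentiableAt ℝ (fderiv ℝ f) z) (v w : E) :
    fderiv ℝ (fun z => fderiv ℝ f z v) z w = fderiv ℝ (fderiv ℝ f) z w v := by
  rw [fderiv_clm_apply hf (differentiableAt_const v)]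
  simp

/-! ### Smoothness and symmetry of the higher derivatives. -/

section smooth

variable (hW : IsOpen W) (hl : ContDiffOn ℝ ∞ l W) (hz : z ∈ W)
include hW hl

theorem contDiffOn_fderiv : ContDiffOn ℝ ∞ (fderiv ℝ l) W :=
  hl.fderiv_of_isOpen hW le_rfl

theorem contDiffOn_fderiv_fderiv : ContDiffOn ℝ ∞ (fderiv ℝ (fderiv ℝ l)) W :=
  (contDiffOn_fderiv hW hl).fderiv_of_isOpen hW le_rfl

theorem contDiffOn_vertHess : ContDiffOn ℝ ∞ (vertHess l) W :=
  contDiffOn_const.clm_comp ((contDiffOn_fderiv_fderiv hW hl).clm_comp contDiffOn_const)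

include hz

theorem differentiableAt_of_mem : DifferentiableAt ℝ l z :=
  ((hl z hz).contDiffAt (hW.mem_nhds hz)).differentiableAt (by simp)

theorem differentiableAt_fderiv : DifferentiableAt ℝ (fderiv ℝ l) z :=
  ((contDiffOn_fderiv hW hl z hz).contDiffAt (hW.mem_nhds hz)).differentiableAt (by simp)

theorem differentiableAt_fderiv_fderiv : DifferentiableAt ℝ (fderiv ℝ (fderiv ℝ l)) z :=
  ((contDiffOn_fderiv_fderiv hW hl z hz).contDiffAt (hW.mem_nhds hz)).differentiableAt (by simp)

theorem differentiableAt_vertHess : DifferentiableAt ℝ (vertHess l) z :=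
  ((contDiffOn_vertHess hW hl z hz).contDiffAt (hW.mem_nhds hz)).differentiableAt (by simp)

theorem fderiv_fderiv_symm (v w : ModelE n) :
    fderiv ℝ (fderiv ℝ l) z v w = fderiv ℝ (fderiv ℝ l) z w v :=
  ((hl z hz).contDiffAt (hW.mem_nhds hz)).isSymmSndFDerivAt
    (by rw [minSmoothness_of_isRCLikeNormedField]; exact ENat.LEInfty.out) v w

theorem vertHess_symm (u v : EuclideanSpace ℝ (Fin n)) : vertHess l z u v = vertHess l z v u :=
  fderiv_fderiv_symm hW hl hz _ _

theorem fderiv_vertHess_apply (w : ModelE n) (u v : EuclideanSpace ℝ (Fin n)) :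
    fderiv ℝ (vertHess l) z w u v =
      fderiv ℝ (fderiv ℝ (fderiv ℝ l)) z w (0, u) (0, v) := by
  have h := differentiableAt_fderiv_fderiv hW hl hz
  have h1 : fderiv ℝ (vertHess l) z w u v = fderiv ℝ (fun z => vertHess l z u v) z w := by
    rw [fderiv_clm_apply ((differentiableAt_vertHess hW hl hz).clm_apply
      (differentiableAt_const u)) (differentiableAt_const v),
      fderiv_clm_apply (differentiableAt_vertHess hW hl hz) (differentiableAt_const u)]
    simp
  rw [h1]
  simp only [vertHess_apply]
  rw [fderiv_clm_apply (h.clm_apply (differentiableAt_const _)) (differentiableAt_const _),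
    fderiv_clm_apply h (differentiableAt_const _)]
  simp

theorem fderiv_vertHess_symm (w : ModelE n) (u v : EuclideanSpace ℝ (Fin n)) :
    fderiv ℝ (vertHess l) z w u v = fderiv ℝ (vertHess l) z w v u := by
  have h1 : ∀ u v, fderiv ℝ (vertHess l) z w u v = fderiv ℝ (fun z => vertHess l z u v) z w := by
    intro u v
    rw [fderiv_clm_apply ((differentiableAt_vertHess hW hl hz).clm_apply
      (differentiableAt_const u)) (differentiableAt_const v),
      fderiv_clm_apply (differentiableAt_vertHess hW hl hz) (differentiableAt_const u)]
    simp
  rw [h1, h1]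
  have : (fun z => vertHess l z u v) =ᶠ[𝓝 z] fun z => vertHess l z v u := by
    filter_upwards [hW.mem_nhds hz] with x hx using vertHess_symm hW hl hx u v
  rw [this.fderiv_eq]

theorem fderiv_fderiv_fderiv_symm (v w : ModelE n) :
    fderiv ℝ (fderiv ℝ (fderiv ℝ l)) z v w = fderiv ℝ (fderiv ℝ (fderiv ℝ l)) z w v :=
  ((contDiffOn_fderiv hW hl z hz).contDiffAt (hW.mem_nhds hz)).isSymmSndFDerivAt
    (by rw [minSmoothness_of_isRCLikeNormedField]; exact ENat.LEInfty.out) v w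

/-- In vertical directions the derivative of the Hessian is the Cartan tensor `∂³l/∂y³`. Schwarz's
theorem for `fderiv ℝ l` exchanges the direction with the first slot; together with
`fderiv_vertHess_symm` this makes the tensor totally symmetric. -/
theorem fderiv_vertHess_vert_symm (u v w : EuclideanSpace ℝ (Fin n)) :
    fderiv ℝ (vertHess l) z (0, w) u v = fderiv ℝ (vertHess l) z (0, u) w v := by
  rw [fderiv_vertHess_apply hW hl hz, fderiv_vertHess_apply hW hl hz,
    fderiv_fderiv_fderiv_symm hW hl hz]

end smooth

/-! ### Consequences of Euler's relation. -/

namespace IsLocalLagrangian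

variable (h : IsLocalLagrangian l W) (hz : z ∈ W)
include h hz

/-- The derivative of Euler's relation in an arbitrary direction; the second term comes from the
factor `z.2`. -/
theorem fderiv_euler (w : ModelE n) :
    fderiv ℝ (fderiv ℝ l) z w (0, z.2) + fderiv ℝ l z (0, w.2) = 2 * fderiv ℝ l z w := by
  have he : (fun z : ModelE n => fderiv ℝ l z (0, z.2)) =ᶠ[𝓝 z] fun z => 2 * l z := by
    filter_upwards [h.isOpen.mem_nhds hz] with x hx using h.euler x hx
  have h1 := congrArg (fun f : ModelE n →L[ℝ] ℝ => f w) he.fderiv_eq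
  have h2 : HasFDerivAt (fun z : ModelE n => ((0, z.2) : ModelE n))
      ((0 : ModelE n →L[ℝ] EuclideanSpace ℝ (Fin n)).prod (ContinuousLinearMap.snd ℝ _ _)) z :=
    (hasFDerivAt_const 0 z).prodMk hasFDerivAt_snd
  rw [fderiv_clm_apply (differentiableAt_fderiv h.isOpen h.contDiffOn hz) h2.differentiableAt,
    h2.fderiv, fderiv_const_mul (differentiableAt_of_mem h.isOpen h.contDiffOn hz)] at h1
  simp at h1
  linarith

theorem vertHess_self (d : EuclideanSpace ℝ (Fin n)) :
    vertHess l z z.2 d = fderiv ℝ l z (0, d) := by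
  have h1 := h.fderiv_euler hz (0, d)
  rw [vertHess_apply, fderiv_fderiv_symm h.isOpen h.contDiffOn hz]
  simp only at h1
  linarith

/-- Obtained by differentiating the identity `vertHess_self`, which holds on all of `W`. Its
vertical and horizontal cases are the contractions with `y` used in the Koszul computations. -/
theorem fderiv_vertHess_self (w : ModelE n) (d : EuclideanSpace ℝ (Fin n)) :
    fderiv ℝ (vertHess l) z w z.2 d + vertHess l z w.2 d =
      fderiv ℝ (fderiv ℝ l) z w (0, d) := by
  have he : (fun z : ModelE n => vertHess l z z.2 d) =ᶠ[𝓝 z] fun z => fderiv ℝ l z (0, d) := by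
    filter_upwards [h.isOpen.mem_nhds hz] with x hx using h.vertHess_self hx d
  have h1 := congrArg (fun f : ModelE n →L[ℝ] ℝ => f w) he.fderiv_eq
  have hd := differentiableAt_vertHess h.isOpen h.contDiffOn hz
  rw [fderiv_fderiv_apply (differentiableAt_fderiv h.isOpen h.contDiffOn hz),
    fderiv_clm_apply (hd.clm_apply differentiableAt_snd) (differentiableAt_const d),
    fderiv_clm_apply hd differentiableAt_snd, fderiv_snd] at h1
  simp at h1
  linarith

/-- The Cartan tensor is annihilated by `y`: for a vertical direction the Hessian terms on the two
sides of `fderiv_vertHess_self` cancel. -/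
theorem fderiv_vertHess_vert_self (u d : EuclideanSpace ℝ (Fin n)) :
    fderiv ℝ (vertHess l) z (0, u) z.2 d = 0 := by
  have h1 := h.fderiv_vertHess_self hz (0, u) d
  rw [← vertHess_apply] at h1
  simp only at h1
  linarith

theorem fderiv_vertHess_horiz_self (u d : EuclideanSpace ℝ (Fin n)) :
    fderiv ℝ (vertHess l) z (u, 0) z.2 d = fderiv ℝ (fderiv ℝ l) z (u, 0) (0, d) := by
  have h1 := h.fderiv_vertHess_self hz (u, 0) d
  simp only [map_zero, zero_apply, add_zero] at h1
  exact h1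

theorem fderiv_vertHess_horiz_self_self (u : EuclideanSpace ℝ (Fin n)) :
    fderiv ℝ (vertHess l) z (u, 0) z.2 z.2 = 2 * fderiv ℝ l z (u, 0) := by
  rw [h.fderiv_vertHess_horiz_self hz]
  have h1 := h.fderiv_euler hz (u, 0)
  simp only [Prod.mk_zero_zero, map_zero, add_zero] at h1
  exact h1

end IsLocalLagrangian

/-! ### Raising an index -/

/-- The vector obtained from a linear form by means of the inverse of the vertical Hessian. -/
def raiseIndex (l : ModelE n → ℝ) (z : ModelE n) (f : EuclideanSpace ℝ (Fin n) → ℝ) :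
    EuclideanSpace ℝ (Fin n) :=
  WithLp.toLp 2 fun a => ∑ d, gUp l a d z * f (EuclideanSpace.single d 1)

theorem gLow_eq (hl : DifferentiableAt ℝ (fderiv ℝ l) z) (a b : Fin n) :
    gLow l a b z = vertHess l z (EuclideanSpace.single a 1) (EuclideanSpace.single b 1) :=
  fderiv_fderiv_apply hl _ _

namespace IsLocalLagrangian

variable (h : IsLocalLagrangian l W)
include h

theorem gLow_eq (hz : z ∈ W) (a b : Fin n) :
    gLow l a b z = vertHess l z (EuclideanSpace.single a 1) (EuclideanSpace.single b 1) :=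
  FinslerGeometry.gLow_eq (differentiableAt_fderiv h.isOpen h.contDiffOn hz) a b

theorem det_ne_zero (hz : z ∈ W) : (Matrix.of fun i j => gLow l i j z).det ≠ 0 := by
  intro hdet
  obtain ⟨v, hv, hv0⟩ := Matrix.exists_mulVec_eq_zero_iff.2 hdet
  apply hv
  have h1 : (WithLp.toLp 2 v : EuclideanSpace ℝ (Fin n)) = 0 := by
    apply h.nondegenerate z hz
    have h2 : ∀ i, vertHess l z (EuclideanSpace.single i 1) (WithLp.toLp 2 v) = 0 := by
      intro i
      refine Eq.trans ?_ (congrFun hv0 i)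
      rw [← sum_single (WithLp.toLp 2 v)]
      simp only [map_sum, map_smul, ← h.gLow_eq hz, smul_eq_mul]
      simp only [Matrix.mulVec, dotProduct, Matrix.of_apply]
      exact Finset.sum_congr rfl fun j _ => mul_comm _ _
    intro w
    rw [vertHess_symm h.isOpen h.contDiffOn hz, ← sum_single w]
    simp only [map_sum, map_smul, sum_apply, smul_apply, h2, smul_zero, Finset.sum_const_zero]
  exact congrArg WithLp.ofLp h1

/-- `raiseIndex` is a coordinate sum that sees only the values of `f` on the basis, as in the
formulas for `G` and `Γ`. For linear `f` it is characterised invariantly by this identity, through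
which those formulas are used below. -/
theorem vertHess_raiseIndex (hz : z ∈ W) (f : EuclideanSpace ℝ (Fin n) →ₗ[ℝ] ℝ)
    (d : EuclideanSpace ℝ (Fin n)) : vertHess l z (raiseIndex l z f) d = f d := by
  have hu : IsUnit (Matrix.of fun i j => gLow l i j z).det := (h.det_ne_zero hz).isUnit
  have h1 : ∀ i, vertHess l z (EuclideanSpace.single i 1) (raiseIndex l z f) =
      f (EuclideanSpace.single i 1) := by
    intro i
    have h2 : (Matrix.of fun i j => gLow l i j z).mulVec
        ((Matrix.of fun i j => gLow l i j z)⁻¹.mulVec fun d => f (EuclideanSpace.single d 1)) =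
        fun d => f (EuclideanSpace.single d 1) := by
      rw [Matrix.mulVec_mulVec, Matrix.mul_nonsing_inv _ hu, Matrix.one_mulVec]
    refine Eq.trans ?_ (congrFun h2 i)
    rw [← sum_single (raiseIndex l z f)]
    simp only [map_sum, map_smul, ← h.gLow_eq hz, smul_eq_mul]
    simp only [Matrix.mulVec, dotProduct, Matrix.of_apply]
    exact Finset.sum_congr rfl fun j _ => mul_comm _ _
  rw [vertHess_symm h.isOpen h.contDiffOn hz, ← sum_single d]
  simp only [map_sum, map_smul, sum_apply, smul_apply, h1]

/-- Non-degeneracy lets an equality of vectors be tested with the index lowered, where no inverse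
matrix appears. -/
theorem eq_of_vertHess_eq (hz : z ∈ W) {u v : EuclideanSpace ℝ (Fin n)}
    (huv : ∀ d, vertHess l z u d = vertHess l z v d) : u = v := by
  rw [← sub_eq_zero]
  apply h.nondegenerate z hz
  intro d
  rw [map_sub, sub_apply, huv, sub_self]

/-- Cramer's rule: the inverse is the adjugate divided by the determinant, and both are polynomial
in the entries. -/
theorem contDiffOn_gUp (a b : Fin n) : ContDiffOn ℝ ∞ (gUp l a b) W := by
  have hlow : ∀ i j, ContDiffOn ℝ ∞ (gLow l i j) W := fun i j =>
    (((contDiffOn_vertHess h.isOpen h.contDiffOn).clm_apply contDiffOn_const).clm_apply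
      contDiffOn_const).congr fun z hz => h.gLow_eq hz i j
  have hdet : ∀ m : Fin n → Fin n → ModelE n → ℝ, (∀ i j, ContDiffOn ℝ ∞ (m i j) W) →
      ContDiffOn ℝ ∞ (fun z => (Matrix.of fun i j => m i j z).det) W := by
    intro m hm
    simp only [Matrix.det_apply]
    refine ContDiffOn.sum fun σ _ => ContDiffOn.const_smul _ ?_
    exact contDiffOn_prod fun i _ => hm _ _
  have hadj : ContDiffOn ℝ ∞ (fun z => (Matrix.of fun i j => gLow l i j z).adjugate a b) W := by
    -- The entry `a b` of the adjugate is the determinant of the matrix with row `b` replaced by the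
    -- basis vector `a`.
    have h1 := hdet (fun i j z => if i = b then (Pi.single a 1 : Fin n → ℝ) j else gLow l i j z)
      (fun i j => by
        by_cases hi : i = b
        · simpa [hi] using contDiffOn_const
        · simpa [hi] using hlow i j)
    refine h1.congr fun z _ => ?_
    rw [Matrix.adjugate_apply]
    congr 1
    ext i j
    simp [Matrix.updateRow_apply]
  have h2 : ContDiffOn ℝ ∞ (fun z => ((Matrix.of fun i j => gLow l i j z).det)⁻¹ *
      (Matrix.of fun i j => gLow l i j z).adjugate a b) W :=
    ((hdet _ hlow).inv fun z hz => h.det_ne_zero hz).mul hadj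
  refine h2.congr fun z _ => ?_
  rw [gUp, Matrix.inv_def, Matrix.smul_apply, Ring.inverse_eq_inv', smul_eq_mul]

theorem contDiffOn_raiseIndex {E : Type*} [NormedAddCommGroup E] [NormedSpace ℝ E]
    {s : Set E} {c : E → ModelE n} {f : E → EuclideanSpace ℝ (Fin n) → ℝ}
    (hc : ContDiffOn ℝ ∞ c s) (hcs : Set.MapsTo c s W)
    (hf : ∀ d, ContDiffOn ℝ ∞ (fun x => f x d) s) :
    ContDiffOn ℝ ∞ (fun x => raiseIndex l (c x) (f x)) s := by
  rw [contDiffOn_euclidean]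
  intro a
  change ContDiffOn ℝ ∞ (fun x => ∑ d, gUp l a d (c x) * f x (EuclideanSpace.single d 1)) s
  exact ContDiffOn.sum fun d _ => ((h.contDiffOn_gUp a d).comp hc hcs).mul (hf _)

end IsLocalLagrangian

end

section

open Filter
open scoped ContDiff Topology

variable {n : ℕ}

/-! ### The spray, Barthel's connection and the Chern connection of a local Lagrangian -/

/-- The vector of the spray coefficients. -/
def sprayVec (l : ModelE n → ℝ) (z : ModelE n) : EuclideanSpace ℝ (Fin n) :=
  WithLp.toLp 2 fun a => spray l a z

/-- The linear map with matrix `N^a_c`. -/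
def barthelMap (l : ModelE n → ℝ) (z : ModelE n) :
    EuclideanSpace ℝ (Fin n) →L[ℝ] EuclideanSpace ℝ (Fin n) :=
  (fderiv ℝ (sprayVec l) z).comp (ContinuousLinearMap.inr ℝ _ _)

/-- The horizontal derivatives `δg/δx^c` of the vertical Hessian. -/
def deltaHess (l : ModelE n → ℝ) (z : ModelE n) : EuclideanSpace ℝ (Fin n) →L[ℝ]
    EuclideanSpace ℝ (Fin n) →L[ℝ] EuclideanSpace ℝ (Fin n) →L[ℝ] ℝ :=
  (fderiv ℝ (vertHess l) z).comp (ContinuousLinearMap.inl ℝ _ _ -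
    (ContinuousLinearMap.inr ℝ _ _).comp (barthelMap l z))

/-- The linear form with which the Chern connection is defined by raising an index. -/
def chernForm (l : ModelE n → ℝ) (z : ModelE n) (ξ u : EuclideanSpace ℝ (Fin n)) :
    EuclideanSpace ℝ (Fin n) →ₗ[ℝ] ℝ where
  toFun d := (1 / 2) * (deltaHess l z ξ u d + deltaHess l z u ξ d - deltaHess l z d ξ u)
  map_add' d d' := by simp; ring
  map_smul' c d := by simp; ring

theorem raiseIndex_add (l : ModelE n → ℝ) (z : ModelE n)
    (f g : EuclideanSpace ℝ (Fin n) → ℝ) :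
    raiseIndex l z (fun d => f d + g d) = raiseIndex l z f + raiseIndex l z g := by
  ext a
  simp [raiseIndex, mul_add, Finset.sum_add_distrib]

theorem raiseIndex_smul (l : ModelE n → ℝ) (z : ModelE n) (c : ℝ)
    (f : EuclideanSpace ℝ (Fin n) → ℝ) :
    raiseIndex l z (fun d => c * f d) = c • raiseIndex l z f := by
  ext a
  simp [raiseIndex, Finset.mul_sum, mul_left_comm]

/-- The bilinear map with the coefficients `Γ^a_{bc}` of the Chern connection. -/
def chernMap (l : ModelE n → ℝ) (z : ModelE n) : EuclideanSpace ℝ (Fin n) →ₗ[ℝ]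
    EuclideanSpace ℝ (Fin n) →ₗ[ℝ] EuclideanSpace ℝ (Fin n) :=
  LinearMap.mk₂ ℝ (fun ξ u => raiseIndex l z (chernForm l z ξ u))
    (fun ξ ξ' u => by
      rw [← raiseIndex_add]
      congr 1; funext d; simp [chernForm]; ring)
    (fun c ξ u => by
      rw [← raiseIndex_smul]
      congr 1; funext d; simp [chernForm]; ring)
    (fun ξ u u' => by
      rw [← raiseIndex_add]
      congr 1; funext d; simp [chernForm]; ring)
    (fun c ξ u => by
      rw [← raiseIndex_smul]
      congr 1; funext d; simp [chernForm]; ring)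

theorem chernMap_apply (l : ModelE n → ℝ) (z : ModelE n) (ξ u : EuclideanSpace ℝ (Fin n)) :
    chernMap l z ξ u = raiseIndex l z (chernForm l z ξ u) := rfl

theorem deltaHess_apply (l : ModelE n → ℝ) (z : ModelE n) (ξ : EuclideanSpace ℝ (Fin n)) :
    deltaHess l z ξ = fderiv ℝ (vertHess l) z (ξ, -barthelMap l z ξ) := by
  refine congrArg (fderiv ℝ (vertHess l) z) (Prod.ext ?_ ?_)
  · simp
  · simp

theorem fderiv_vertHess_pair (l : ModelE n → ℝ) (z : ModelE n)
    (a b u v : EuclideanSpace ℝ (Fin n)) : fderiv ℝ (vertHess l) z (a, -b) u v =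
      fderiv ℝ (vertHess l) z (a, 0) u v - fderiv ℝ (vertHess l) z (0, b) u v := by
  have : ((a, -b) : ModelE n) = (a, 0) - (0, b) := by simp
  rw [this, map_sub]
  rfl

namespace IsLocalLagrangian

variable {l : ModelE n → ℝ} {W : Set (ModelE n)} {z : ModelE n} (h : IsLocalLagrangian l W)
  (hz : z ∈ W)
include h hz

theorem pdx_pdy (c d : Fin n) : pdx c (pdy d l) z =
    fderiv ℝ (fderiv ℝ l) z (EuclideanSpace.single c 1, 0) (0, EuclideanSpace.single d 1) :=
  fderiv_fderiv_apply (differentiableAt_fderiv h.isOpen h.contDiffOn hz) _ _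

theorem sprayVec_eq : sprayVec l z = raiseIndex l z (fun d =>
    (1 / 2) * (fderiv ℝ (fderiv ℝ l) z (z.2, 0) (0, d) - fderiv ℝ l z (d, 0))) := by
  ext a
  change spray l a z = ∑ d, gUp l a d z * _
  rw [spray, Finset.mul_sum]
  refine Finset.sum_congr rfl fun d _ => ?_
  have h1 : ∑ c, pdx c (pdy d l) z * z.2 c =
      fderiv ℝ (fderiv ℝ l) z (z.2, 0) (0, EuclideanSpace.single d 1) := by
    have h2 : ((z.2, 0) : ModelE n) =
        ∑ c, z.2 c • ((EuclideanSpace.single c 1, 0) : ModelE n) := by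
      have := congrArg (ContinuousLinearMap.inl ℝ (EuclideanSpace ℝ (Fin n))
        (EuclideanSpace ℝ (Fin n))) (sum_single z.2).symm
      rw [map_sum] at this
      simpa using this
    rw [h2]
    simp only [map_sum, map_smul, sum_apply, smul_apply, smul_eq_mul]
    exact Finset.sum_congr rfl fun c _ => by rw [h.pdx_pdy hz, mul_comm]
  rw [h1, pdx]
  ring

theorem vertHess_sprayVec (d : EuclideanSpace ℝ (Fin n)) : vertHess l z (sprayVec l z) d =
    (1 / 2) * (fderiv ℝ (fderiv ℝ l) z (z.2, 0) (0, d) - fderiv ℝ l z (d, 0)) := by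
  rw [h.sprayVec_eq hz]
  let f : EuclideanSpace ℝ (Fin n) →ₗ[ℝ] ℝ :=
    ((1 / 2 : ℝ) • ((fderiv ℝ (fderiv ℝ l) z (z.2, 0)).comp (ContinuousLinearMap.inr ℝ _ _) -
      (fderiv ℝ l z).comp (ContinuousLinearMap.inl ℝ _ _)) : EuclideanSpace ℝ (Fin n) →L[ℝ] ℝ)
  exact h.vertHess_raiseIndex hz f d

omit hz in
theorem contDiffOn_sprayVec : ContDiffOn ℝ ∞ (sprayVec l) W := by
  refine (h.contDiffOn_raiseIndex contDiffOn_id (fun _ hz => hz) fun d => ?_).congr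
    fun z hz => h.sprayVec_eq hz
  refine contDiffOn_const.mul (ContDiffOn.sub ?_ ?_)
  · exact ((contDiffOn_fderiv_fderiv h.isOpen h.contDiffOn).clm_apply
      (contDiff_snd.prodMk contDiff_const).contDiffOn).clm_apply contDiffOn_const
  · exact (contDiffOn_fderiv h.isOpen h.contDiffOn).clm_apply contDiffOn_const

theorem differentiableAt_sprayVec : DifferentiableAt ℝ (sprayVec l) z :=
  ((h.contDiffOn_sprayVec z hz).contDiffAt (h.isOpen.mem_nhds hz)).differentiableAt (by simp)

theorem barthel_eq (a c : Fin n) :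
    barthel l a c z = barthelMap l z (EuclideanSpace.single c 1) a := by
  have h1 := (EuclideanSpace.proj (𝕜 := ℝ) a).hasFDerivAt.comp z
    (h.differentiableAt_sprayVec hz).hasFDerivAt
  have h2 : spray l a = (EuclideanSpace.proj (𝕜 := ℝ) a) ∘ sprayVec l := rfl
  rw [barthel, pdy, h2, h1.fderiv]
  rfl

theorem delta_gLow (a b c : Fin n) : delta l c (gLow l a b) z =
    deltaHess l z (EuclideanSpace.single c 1) (EuclideanSpace.single a 1)
      (EuclideanSpace.single b 1) := by
  have he : gLow l a b =ᶠ[𝓝 z] fun z => vertHess l z (EuclideanSpace.single a 1)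
      (EuclideanSpace.single b 1) := by
    filter_upwards [h.isOpen.mem_nhds hz] with x hx using h.gLow_eq hx a b
  have hd := differentiableAt_vertHess h.isOpen h.contDiffOn hz
  have h1 : ∀ w, fderiv ℝ (gLow l a b) z w = fderiv ℝ (vertHess l) z w
      (EuclideanSpace.single a 1) (EuclideanSpace.single b 1) := by
    intro w
    rw [he.fderiv_eq, fderiv_clm_apply (hd.clm_apply (differentiableAt_const _))
      (differentiableAt_const _), fderiv_clm_apply hd (differentiableAt_const _)]
    simp
  have h2 : ((EuclideanSpace.single c 1, -barthelMap l z (EuclideanSpace.single c 1)) : ModelE n) =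
      (EuclideanSpace.single c 1, 0) -
        ∑ b, barthel l b c z • ((0, EuclideanSpace.single b 1) : ModelE n) := by
    have := congrArg (ContinuousLinearMap.inr ℝ (EuclideanSpace ℝ (Fin n))
      (EuclideanSpace ℝ (Fin n))) (sum_single (barthelMap l z (EuclideanSpace.single c 1))).symm
    rw [map_sum] at this
    simp only [← h.barthel_eq hz, map_smul, ContinuousLinearMap.inr_apply] at this
    rw [← this]
    simp
  rw [deltaHess_apply, h2]
  simp only [delta, pdx, pdy, map_sub, map_sum, map_smul, sub_apply, sum_apply, smul_apply,
    smul_eq_mul, h1]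

theorem deltaHess_symm (ξ u v : EuclideanSpace ℝ (Fin n)) :
    deltaHess l z ξ u v = deltaHess l z ξ v u := by
  rw [deltaHess_apply]
  exact fderiv_vertHess_symm h.isOpen h.contDiffOn hz _ _ _

theorem chernMap_single (a b c : Fin n) :
    chernMap l z (EuclideanSpace.single c 1) (EuclideanSpace.single b 1) a =
      chernGamma l a b c z := by
  rw [chernMap_apply, chernGamma, Finset.mul_sum]
  change ∑ d, gUp l a d z * _ = _
  refine Finset.sum_congr rfl fun d _ => ?_
  rw [h.delta_gLow hz, h.delta_gLow hz, h.delta_gLow hz]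
  change gUp l a d z * ((1 / 2) * _) = _
  rw [h.deltaHess_symm hz (EuclideanSpace.single c 1), h.deltaHess_symm hz
    (EuclideanSpace.single b 1) _ (EuclideanSpace.single d 1), h.deltaHess_symm hz
    (EuclideanSpace.single d 1)]
  ring

theorem vertHess_chernMap (ξ u d : EuclideanSpace ℝ (Fin n)) :
    vertHess l z (chernMap l z ξ u) d =
      (1 / 2) * (deltaHess l z ξ u d + deltaHess l z u ξ d - deltaHess l z d ξ u) :=
  h.vertHess_raiseIndex hz (chernForm l z ξ u) d

theorem chernMap_symm (ξ u : EuclideanSpace ℝ (Fin n)) :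
    chernMap l z ξ u = chernMap l z u ξ := by
  apply h.eq_of_vertHess_eq hz
  intro d
  rw [h.vertHess_chernMap hz, h.vertHess_chernMap hz, h.deltaHess_symm hz d]
  ring

theorem chernMap_compatible (ξ u v : EuclideanSpace ℝ (Fin n)) :
    deltaHess l z ξ u v = vertHess l z (chernMap l z ξ u) v + vertHess l z u (chernMap l z ξ v) := by
  rw [vertHess_symm h.isOpen h.contDiffOn hz u, h.vertHess_chernMap hz, h.vertHess_chernMap hz,
    h.deltaHess_symm hz ξ v u, h.deltaHess_symm hz v ξ u, h.deltaHess_symm hz u ξ v]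
  ring

/-- Since `N` is the vertical derivative of `G`, its lowered form comes from differentiating
`vertHess_sprayVec` in the direction `(0, ξ)`. The derivative that falls on the Hessian leaves the
Cartan term with `G`. -/
theorem vertHess_barthelMap (ξ d : EuclideanSpace ℝ (Fin n)) :
    vertHess l z (barthelMap l z ξ) d =
      (1 / 2) * (fderiv ℝ (vertHess l) z (z.2, 0) ξ d + fderiv ℝ (vertHess l) z (ξ, 0) z.2 d -
        fderiv ℝ (vertHess l) z (d, 0) z.2 ξ) -
      fderiv ℝ (vertHess l) z (0, ξ) (sprayVec l z) d := by
  have he : (fun z => vertHess l z (sprayVec l z) d) =ᶠ[𝓝 z] fun z : ModelE n =>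
      (1 / 2) * (fderiv ℝ (fderiv ℝ l) z (z.2, 0) (0, d) - fderiv ℝ l z (d, 0)) := by
    filter_upwards [h.isOpen.mem_nhds hz] with x hx using h.vertHess_sprayVec hx d
  have h1 := congrArg (fun f : ModelE n →L[ℝ] ℝ => f (0, ξ)) he.fderiv_eq
  have hd := differentiableAt_vertHess h.isOpen h.contDiffOn hz
  have hs := h.differentiableAt_sprayVec hz
  have hl1 := differentiableAt_fderiv h.isOpen h.contDiffOn hz
  have hl2 := differentiableAt_fderiv_fderiv h.isOpen h.contDiffOn hz
  have hy : HasFDerivAt (fun z : ModelE n => ((z.2, 0) : ModelE n))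
      ((ContinuousLinearMap.snd ℝ _ _).prod (0 : ModelE n →L[ℝ] EuclideanSpace ℝ (Fin n))) z :=
    hasFDerivAt_snd.prodMk (hasFDerivAt_const 0 z)
  rw [fderiv_clm_apply (hd.clm_apply hs) (differentiableAt_const d),
    fderiv_clm_apply hd hs, fderiv_const_mul
      (((hl2.clm_apply hy.differentiableAt).clm_apply (differentiableAt_const _)).fun_sub
        (hl1.clm_apply (differentiableAt_const _))),
    fderiv_fun_sub ((hl2.clm_apply hy.differentiableAt).clm_apply (differentiableAt_const _))
        (hl1.clm_apply (differentiableAt_const _)),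
    fderiv_clm_apply (hl2.clm_apply hy.differentiableAt) (differentiableAt_const _),
    fderiv_clm_apply hl2 hy.differentiableAt, hy.fderiv,
    fderiv_clm_apply hl1 (differentiableAt_const _)] at h1
  simp at h1
  rw [fderiv_vertHess_apply h.isOpen h.contDiffOn hz (z.2, 0) ξ d,
    ← fderiv_fderiv_fderiv_symm h.isOpen h.contDiffOn hz,
    h.fderiv_vertHess_horiz_self hz, h.fderiv_vertHess_horiz_self hz,
    fderiv_fderiv_symm h.isOpen h.contDiffOn hz (d, 0)]
  have h2 : vertHess l z (barthelMap l z ξ) d =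
    vertHess l z (fderiv ℝ (sprayVec l) z (0, ξ)) d := rfl
  rw [h2]
  linarith

theorem vertHess_two_sprayVec (d : EuclideanSpace ℝ (Fin n)) :
    vertHess l z ((2 : ℝ) • sprayVec l z) d =
      fderiv ℝ (vertHess l) z (z.2, 0) z.2 d - (1 / 2) * fderiv ℝ (vertHess l) z (d, 0) z.2 z.2 := by
  rw [map_smul, smul_apply, h.vertHess_sprayVec hz, h.fderiv_vertHess_horiz_self hz,
    h.fderiv_vertHess_horiz_self_self hz, smul_eq_mul]
  ring

/-- A symmetric bilinear map that is compatible with the vertical Hessian in the horizontal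
directions that it defines induces Barthel's connection. -/
theorem barthelMap_unique
    {Γ : EuclideanSpace ℝ (Fin n) → EuclideanSpace ℝ (Fin n) → EuclideanSpace ℝ (Fin n)}
    (hsymm : ∀ ξ u, Γ ξ u = Γ u ξ)
    (hcomp : ∀ ξ u v, fderiv ℝ (vertHess l) z (ξ, -Γ ξ z.2) u v =
      vertHess l z (Γ ξ u) v + vertHess l z u (Γ ξ v)) (ξ : EuclideanSpace ℝ (Fin n)) :
    Γ ξ z.2 = barthelMap l z ξ := by
  have hs := vertHess_symm h.isOpen h.contDiffOn hz
  have hds := fderiv_vertHess_symm h.isOpen h.contDiffOn hz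
  have hvs : ∀ b v : EuclideanSpace ℝ (Fin n), fderiv ℝ (vertHess l) z (0, b) v z.2 = 0 := by
    intro b v
    rw [hds]
    exact h.fderiv_vertHess_vert_self hz b v
  have key : ∀ ξ d, vertHess l z (Γ ξ z.2) d = (1 / 2) * (fderiv ℝ (vertHess l) z (ξ, 0) d z.2 +
      fderiv ℝ (vertHess l) z (z.2, 0) d ξ - fderiv ℝ (vertHess l) z (0, Γ z.2 z.2) d ξ -
      fderiv ℝ (vertHess l) z (d, 0) ξ z.2) := by
    intro ξ d
    -- The Koszul combination `e1 + e2 - e3`. The vertical corrections in `e1` and `e3` vanish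
    -- because one argument is `y`, so the only unknown on the right is `Γ(y, y)`.
    have e1 := hcomp ξ d z.2
    have e2 := hcomp z.2 d ξ
    have e3 := hcomp d ξ z.2
    rw [fderiv_vertHess_pair] at e1 e2 e3
    rw [hvs] at e1 e3
    rw [hsymm d ξ] at e3
    rw [hsymm z.2 d, hsymm z.2 ξ] at e2
    rw [hs d] at e1 e2
    rw [hs ξ] at e3
    rw [hs (Γ d z.2)] at e2
    rw [hs (Γ ξ d)] at e1
    rw [hs (Γ d z.2)] at e3
    rw [hs (Γ ξ d)] at e3
    linarith
  -- For `ξ = y` the last Cartan term of `key` disappears as well, which determines `Γ(y, y)`;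
  -- inserted back into `key`, this determines `Γ(ξ, y)`.
  have h2 : Γ z.2 z.2 = (2 : ℝ) • sprayVec l z := by
    apply h.eq_of_vertHess_eq hz
    intro d
    rw [key, h.vertHess_two_sprayVec hz, hvs, hds (z.2, 0) d]
    ring
  apply h.eq_of_vertHess_eq hz
  intro d
  rw [key, h2, h.vertHess_barthelMap hz, hds (ξ, 0) d, hds (z.2, 0) d, hds (d, 0) ξ,
    fderiv_vertHess_vert_symm h.isOpen h.contDiffOn hz (sprayVec l z)]
  have h3 : ((0, (2 : ℝ) • sprayVec l z) : ModelE n) = (2 : ℝ) • (0, sprayVec l z) := by simp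
  rw [h3, map_smul]
  simp only [smul_apply, smul_eq_mul]
  rw [hds _ d ξ]
  ring

/-- Euler's relation for the spray coefficients, of degree two. It is read off from the lowered
formula for `N`, where the Cartan term vanishes at `ξ = y`. -/
theorem barthelMap_self : barthelMap l z z.2 = (2 : ℝ) • sprayVec l z := by
  apply h.eq_of_vertHess_eq hz
  intro d
  rw [h.vertHess_two_sprayVec hz, h.vertHess_barthelMap hz,
    fderiv_vertHess_vert_symm h.isOpen h.contDiffOn hz (sprayVec l z),
    fderiv_vertHess_symm h.isOpen h.contDiffOn hz, fderiv_vertHess_symm h.isOpen h.contDiffOn hz,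
    fderiv_vertHess_symm h.isOpen h.contDiffOn hz, h.fderiv_vertHess_vert_self hz]
  ring

/-- Consistency of the definition: the horizontal directions used to build the Chern coefficients
are the ones that these coefficients define. Thus compatibility in the sense of
`chernMap_compatible` is the self-referential compatibility required in `chernMap_unique`. -/
theorem chernMap_self (ξ : EuclideanSpace ℝ (Fin n)) :
    chernMap l z ξ z.2 = barthelMap l z ξ := by
  have hds := fderiv_vertHess_symm h.isOpen h.contDiffOn hz
  have hvs : ∀ b v : EuclideanSpace ℝ (Fin n), fderiv ℝ (vertHess l) z (0, b) v z.2 = 0 := by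
    intro b v
    rw [hds]
    exact h.fderiv_vertHess_vert_self hz b v
  apply h.eq_of_vertHess_eq hz
  intro d
  have h3 : ((0, (2 : ℝ) • sprayVec l z) : ModelE n) = (2 : ℝ) • (0, sprayVec l z) := by simp
  rw [h.vertHess_chernMap hz, h.vertHess_barthelMap hz]
  simp only [deltaHess_apply, fderiv_vertHess_pair]
  rw [h.barthelMap_self hz, h3, map_smul, hvs, h.fderiv_vertHess_vert_self hz,
    fderiv_vertHess_vert_symm h.isOpen h.contDiffOn hz (sprayVec l z) d ξ, hds (d, 0) ξ]
  simp only [smul_apply, smul_eq_mul]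
  ring

/-- Once `barthelMap_unique` has identified the horizontal directions, compatibility speaks of the
known derivatives `deltaHess`, and the Levi-Civita argument applies: a symmetric metric `Γ` is given
by the Koszul formula. -/
theorem chernMap_unique
    {Γ : EuclideanSpace ℝ (Fin n) →ₗ[ℝ] EuclideanSpace ℝ (Fin n) →ₗ[ℝ] EuclideanSpace ℝ (Fin n)}
    (hsymm : ∀ ξ u, Γ ξ u = Γ u ξ)
    (hcomp : ∀ ξ u v, fderiv ℝ (vertHess l) z (ξ, -Γ ξ z.2) u v =
      vertHess l z (Γ ξ u) v + vertHess l z u (Γ ξ v)) : Γ = chernMap l z := by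
  have hN := h.barthelMap_unique hz hsymm hcomp
  have hs := vertHess_symm h.isOpen h.contDiffOn hz
  have hc : ∀ ξ u v, deltaHess l z ξ u v =
      vertHess l z (Γ ξ u) v + vertHess l z u (Γ ξ v) := by
    intro ξ u v
    rw [deltaHess_apply, ← hN, hcomp]
  refine LinearMap.ext₂ fun ξ u => ?_
  apply h.eq_of_vertHess_eq hz
  intro d
  rw [h.vertHess_chernMap hz, hc, hc, hc, hsymm u ξ, hsymm d ξ, hsymm d u, hs ξ, hs u]
  rw [hs (Γ u d)]
  ring

end IsLocalLagrangian

end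

/-! ### Smooth dependence of the Chern coefficients; homogeneity and second derivatives along rays
and lines. -/

section

open Filter
open scoped ContDiff Topology

variable {n : ℕ} {l : ModelE n → ℝ} {W : Set (ModelE n)} {z : ModelE n}

theorem contDiffOn_fderiv_apply_comp {E F G : Type*} [NormedAddCommGroup E] [NormedSpace ℝ E]
    [NormedAddCommGroup F] [NormedSpace ℝ F] [NormedAddCommGroup G] [NormedSpace ℝ G]
    {f : E → F} {W : Set E} {S : Set G} {x v : G → E} (hf : ContDiffOn ℝ ∞ f W) (hW : IsOpen W)
    (hx : ContDiffOn ℝ ∞ x S) (hv : ContDiffOn ℝ ∞ v S) (hmaps : Set.MapsTo x S W) :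
    ContDiffOn ℝ ∞ (fun s => fderiv ℝ f (x s) (v s)) S :=
  ((hf.fderiv_of_isOpen hW le_rfl).comp hx hmaps).clm_apply hv

/-- Smoothness is stated jointly in the point and both arguments, since the values of `chernMap` are
purely algebraic bilinear maps. -/
theorem IsLocalLagrangian.contDiffOn_chernMap (h : IsLocalLagrangian l W) :
    ContDiffOn ℝ ∞ (fun x : ModelE n × EuclideanSpace ℝ (Fin n) × EuclideanSpace ℝ (Fin n) =>
      chernMap l x.1 x.2.1 x.2.2) (W ×ˢ Set.univ) := by
  have hmaps : Set.MapsTo Prod.fst (W ×ˢ (Set.univ :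
      Set (EuclideanSpace ℝ (Fin n) × EuclideanSpace ℝ (Fin n)))) W := fun x hx => hx.1
  have hD : ∀ ξ : ModelE n × EuclideanSpace ℝ (Fin n) × EuclideanSpace ℝ (Fin n) →
      EuclideanSpace ℝ (Fin n), ContDiffOn ℝ ∞ ξ (W ×ˢ Set.univ) →
      ContDiffOn ℝ ∞ (fun x => deltaHess l x.1 (ξ x)) (W ×ˢ Set.univ) := by
    intro ξ hξ
    simp only [deltaHess_apply]
    refine contDiffOn_fderiv_apply_comp (contDiffOn_vertHess h.isOpen h.contDiffOn) h.isOpen contDiffOn_fst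
      (hξ.prodMk (ContDiffOn.neg ?_)) hmaps
    exact contDiffOn_fderiv_apply_comp h.contDiffOn_sprayVec h.isOpen contDiffOn_fst
      (contDiffOn_const.prodMk hξ) hmaps
  have h1 : ContDiffOn ℝ ∞ (fun x : ModelE n × EuclideanSpace ℝ (Fin n) ×
      EuclideanSpace ℝ (Fin n) => x.2.1) (W ×ˢ Set.univ) :=
    (contDiff_fst.comp contDiff_snd).contDiffOn
  have h2 : ContDiffOn ℝ ∞ (fun x : ModelE n × EuclideanSpace ℝ (Fin n) ×
      EuclideanSpace ℝ (Fin n) => x.2.2) (W ×ˢ Set.univ) :=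
    (contDiff_snd.comp contDiff_snd).contDiffOn
  refine h.contDiffOn_raiseIndex contDiffOn_fst hmaps fun d => ?_
  refine contDiffOn_const.mul (ContDiffOn.sub (ContDiffOn.add ?_ ?_) ?_)
  · exact ((hD _ h1).clm_apply h2).clm_apply contDiffOn_const
  · exact ((hD _ h2).clm_apply h1).clm_apply contDiffOn_const
  · exact ((hD _ contDiffOn_const).clm_apply h1).clm_apply h2

theorem hasDerivAt_ray (z : ModelE n) (s : ℝ) :
    HasDerivAt (fun s : ℝ => ((z.1, s • z.2) : ModelE n)) (0, z.2) s := by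
  have h := (hasDerivAt_const s z.1).prodMk ((hasDerivAt_id s).smul_const z.2)
  simpa using h

theorem euler_of_homogeneous (hl : DifferentiableAt ℝ l z)
    (hom : ∀ s : ℝ, 0 < s → l (z.1, s • z.2) = s ^ 2 * l z) :
    fderiv ℝ l z (0, z.2) = 2 * l z := by
  have hz : ((z.1, (1 : ℝ) • z.2) : ModelE n) = z := by simp
  have h1 : HasDerivAt (fun s : ℝ => l (z.1, s • z.2)) (fderiv ℝ l z (0, z.2)) 1 := by
    have hl' : HasFDerivAt l (fderiv ℝ l z) (z.1, (1 : ℝ) • z.2) := by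
      rw [hz]
      exact hl.hasFDerivAt
    exact hl'.comp_hasDerivAt (1 : ℝ) (hasDerivAt_ray z 1)
  have h2 : HasDerivAt (fun s : ℝ => s ^ 2 * l z) (2 * l z) 1 := by
    simpa using (hasDerivAt_pow 2 (1 : ℝ)).mul_const (l z)
  have he : (fun s : ℝ => l (z.1, s • z.2)) =ᶠ[𝓝 1] fun s => s ^ 2 * l z := by
    filter_upwards [lt_mem_nhds (zero_lt_one' ℝ)] with s hs using hom s hs
  exact h1.unique (h2.congr_of_eventuallyEq he)

/-- By Euler's relation along the ray, `l (x, s y) / s²` has derivative zero for `s > 0`, hence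
equals its value at `s = 1`. -/
theorem homogeneous_of_euler (hl : ∀ s : ℝ, 0 < s → DifferentiableAt ℝ l (z.1, s • z.2))
    (heuler : ∀ s : ℝ, 0 < s → fderiv ℝ l (z.1, s • z.2) (0, s • z.2) = 2 * l (z.1, s • z.2))
    {s : ℝ} (hs : 0 < s) : l (z.1, s • z.2) = s ^ 2 * l z := by
  have hd : ∀ s : ℝ, 0 < s → HasDerivAt (fun s : ℝ => l (z.1, s • z.2) / s ^ 2) 0 s := by
    intro s hs
    have h1 : HasDerivAt (fun s : ℝ => l (z.1, s • z.2))
        (fderiv ℝ l (z.1, s • z.2) (0, z.2)) s :=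
      (hl s hs).hasFDerivAt.comp_hasDerivAt s (hasDerivAt_ray z s)
    have h2 := h1.div (hasDerivAt_pow 2 s) (pow_ne_zero 2 hs.ne')
    convert! h2 using 1
    have h3 : ((0, s • z.2) : ModelE n) = s • (0, z.2) := by simp
    have h4 := heuler s hs
    rw [h3, map_smul, smul_eq_mul] at h4
    rw [eq_comm, div_eq_zero_iff]
    left
    push_cast
    linear_combination s * h4
  have h1 := isOpen_Ioi.is_const_of_deriv_eq_zero isPreconnected_Ioi
    (fun s hs => (hd s hs).differentiableAt.differentiableWithinAt) (fun s hs => (hd s hs).deriv)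
    (Set.mem_Ioi.2 hs) (Set.mem_Ioi.2 zero_lt_one)
  have h2 : ((z.1, (1 : ℝ) • z.2) : ModelE n) = z := by simp
  rw [h2, one_pow, div_one, div_eq_iff (pow_ne_zero 2 hs.ne')] at h1
  rw [h1, mul_comm]

theorem deriv_deriv_eq_vertHess (hW : IsOpen W) (hl : ContDiffOn ℝ ∞ l W) (hz : z ∈ W)
    (u v : EuclideanSpace ℝ (Fin n)) :
    deriv (fun r : ℝ => deriv (fun s : ℝ => l (z.1, z.2 + r • u + s • v)) 0) 0 =
      vertHess l z u v := by
  have hc : ∀ w : EuclideanSpace ℝ (Fin n), HasDerivAt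
      (fun r : ℝ => ((z.1, w + r • u) : ModelE n)) (0, u) 0 := by
    intro w
    have h := (hasDerivAt_const (0 : ℝ) z.1).prodMk
      (((hasDerivAt_id (0 : ℝ)).smul_const u).const_add w)
    simpa using h
  have hc' : ∀ w : EuclideanSpace ℝ (Fin n), HasDerivAt
      (fun r : ℝ => ((z.1, w + r • v) : ModelE n)) (0, v) 0 := by
    intro w
    have h := (hasDerivAt_const (0 : ℝ) z.1).prodMk
      (((hasDerivAt_id (0 : ℝ)).smul_const v).const_add w)
    simpa using h
  have h0 : ((z.1, z.2 + (0 : ℝ) • u) : ModelE n) = z := by simp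
  have h1 : (fun r : ℝ => deriv (fun s : ℝ => l (z.1, z.2 + r • u + s • v)) 0) =ᶠ[𝓝 0]
      fun r => fderiv ℝ l (z.1, z.2 + r • u) (0, v) := by
    -- The inner derivative is known only where the displaced point stays in `W`, that is for `r`
    -- near `0`.
    have hmem : ∀ᶠ r : ℝ in 𝓝 0, ((z.1, z.2 + r • u) : ModelE n) ∈ W := by
      apply (hc z.2).continuousAt.eventually_mem
      rw [h0]
      exact hW.mem_nhds hz
    filter_upwards [hmem] with r hr
    have h2 : ((z.1, z.2 + r • u + (0 : ℝ) • v) : ModelE n) = (z.1, z.2 + r • u) := by simp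
    have h3 := differentiableAt_of_mem hW hl hr
    rw [← h2] at h3 ⊢
    exact (h3.hasFDerivAt.comp_hasDerivAt (0 : ℝ) (hc' _)).deriv
  rw [h1.deriv_eq]
  have h4 := differentiableAt_fderiv hW hl hz
  have h5 : HasFDerivAt (fun z => fderiv ℝ l z (0, v))
      (fderiv ℝ (fun z => fderiv ℝ l z (0, v)) z) (z.1, z.2 + (0 : ℝ) • u) := by
    rw [h0]
    exact (h4.clm_apply (differentiableAt_const _)).hasFDerivAt
  refine (h5.comp_hasDerivAt (0 : ℝ) (hc z.2)).deriv.trans ?_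
  rw [fderiv_fderiv_apply h4, vertHess_apply]

end

section

open Bundle Filter
open scoped Manifold ContDiff Topology

variable {n : ℕ} {M : Type*} [TopologicalSpace M] [ChartedSpace (EuclideanSpace ℝ (Fin n)) M]
  [IsManifold (𝓡 n) ∞ M]

/-! ### Induced coordinates on the tangent bundle -/

/-- The coordinates `(x, y)` on `TM` induced by a chart of `M`. -/
def tanCoords (φ : OpenPartialHomeomorph M (EuclideanSpace ℝ (Fin n)))
    (v : TangentBundle (𝓡 n) M) : ModelE n :=
  (φ v.1, mfderiv (𝓡 n) (𝓡 n) φ v.1 v.2)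

/-- The point of `TM` with given induced coordinates. -/
def tanPoint (φ : OpenPartialHomeomorph M (EuclideanSpace ℝ (Fin n)))
    (z : ModelE n) : TangentBundle (𝓡 n) M :=
  tangentMap (𝓡 n) (𝓡 n) φ.symm ⟨z.1, z.2⟩

variable {φ : OpenPartialHomeomorph M (EuclideanSpace ℝ (Fin n))}

theorem contMDiffAt_tanCoords (hφ : φ ∈ IsManifold.maximalAtlas (𝓡 n) ∞ M)
    {v : TangentBundle (𝓡 n) M} (hv : v.1 ∈ φ.source) :
    ContMDiffAt (IE n) 𝓘(ℝ, ModelE n) ∞ (tanCoords φ) v := by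
  have h1 : ContMDiffAt (IE n) 𝓘(ℝ, EuclideanSpace ℝ (Fin n)) ∞
      (fun v : TangentBundle (𝓡 n) M => φ v.1) v :=
    ((contMDiffOn_of_mem_maximalAtlas hφ).contMDiffAt (φ.open_source.mem_nhds hv)).comp v
      (contMDiff_proj (TangentSpace (𝓡 n) : M → Type)).contMDiffAt
  have h2 : ContMDiffAt (IE n) (IE n) ∞ (tangentMap (𝓡 n) (𝓡 n) φ) v := by
    have h := (contMDiffOn_of_mem_maximalAtlas hφ).contMDiffOn_tangentMapWithin (m := ∞) le_rfl
      φ.open_source.uniqueMDiffOn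
    have hopen : IsOpen (TotalSpace.proj ⁻¹' φ.source : Set (TangentBundle (𝓡 n) M)) :=
      φ.open_source.preimage (FiberBundle.continuous_proj _ _)
    refine ((h v hv).contMDiffAt (hopen.mem_nhds hv)).congr_of_eventuallyEq ?_
    filter_upwards [hopen.mem_nhds hv] with w hw
    simp only [tangentMap, tangentMapWithin]
    rw [mfderivWithin_of_isOpen φ.open_source hw]
  have h3 := ((contMDiff_snd_tangentBundle_modelSpace (n := ∞) (EuclideanSpace ℝ (Fin n))
    (𝓡 n)).contMDiffAt (x := tangentMap (𝓡 n) (𝓡 n) φ v)).comp v h2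
  exact h1.prodMk_space h3

theorem contMDiffAt_tanPoint (hφ : φ ∈ IsManifold.maximalAtlas (𝓡 n) ∞ M)
    {z : ModelE n} (hz : z.1 ∈ φ.target) :
    ContMDiffAt 𝓘(ℝ, ModelE n) (IE n) ∞ (tanPoint φ) z := by
  have h1 : ContMDiffAt 𝓘(ℝ, ModelE n) (IE n) ∞
      (fun z : ModelE n => (⟨z.1, z.2⟩ : TangentBundle (𝓡 n) (EuclideanSpace ℝ (Fin n)))) z := by
    refine Bundle.contMDiffAt_totalSpace.2 ⟨contDiff_fst.contMDiff.contMDiffAt, ?_⟩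
    have : (fun x : ModelE n => (trivializationAt (EuclideanSpace ℝ (Fin n))
        (TangentSpace (𝓡 n) : EuclideanSpace ℝ (Fin n) → Type) z.1
        (⟨x.1, x.2⟩ : TangentBundle (𝓡 n) (EuclideanSpace ℝ (Fin n)))).2) = fun x => x.2 := by
      funext x
      simp
    exact this ▸ contDiff_snd.contMDiff.contMDiffAt
  have h := (contMDiffOn_symm_of_mem_maximalAtlas hφ).contMDiffOn_tangentMapWithin (m := ∞) le_rfl
      φ.open_target.uniqueMDiffOn
  have hopen : IsOpen (TotalSpace.proj ⁻¹' φ.target :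
      Set (TangentBundle (𝓡 n) (EuclideanSpace ℝ (Fin n)))) :=
    φ.open_target.preimage (FiberBundle.continuous_proj _ _)
  have h2 : ContMDiffAt (IE n) (IE n) ∞ (tangentMap (𝓡 n) (𝓡 n) φ.symm)
      (⟨z.1, z.2⟩ : TangentBundle (𝓡 n) (EuclideanSpace ℝ (Fin n))) := by
    refine ((h ⟨z.1, z.2⟩ hz).contMDiffAt (hopen.mem_nhds hz)).congr_of_eventuallyEq ?_
    filter_upwards [hopen.mem_nhds hz] with w hw
    simp only [tangentMap, tangentMapWithin]
    rw [mfderivWithin_of_isOpen φ.open_target hw]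
  exact h2.comp z h1

theorem mdifferentiable_of_mem_maximalAtlas' (hφ : φ ∈ IsManifold.maximalAtlas (𝓡 n) ∞ M) :
    φ.MDifferentiable (𝓡 n) (𝓡 n) :=
  ⟨(contMDiffOn_of_mem_maximalAtlas hφ).mdifferentiableOn (by simp),
    (contMDiffOn_symm_of_mem_maximalAtlas hφ).mdifferentiableOn (by simp)⟩

theorem tanCoords_tanPoint (hφ : φ ∈ IsManifold.maximalAtlas (𝓡 n) ∞ M)
    {z : ModelE n} (hz : z.1 ∈ φ.target) : tanCoords φ (tanPoint φ z) = z := by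
  have h := (mdifferentiable_of_mem_maximalAtlas' hφ).comp_symm_deriv hz
  refine Prod.ext (φ.right_inv hz) ?_
  exact congrArg (fun f => f z.2) h

theorem tanPoint_tanCoords (hφ : φ ∈ IsManifold.maximalAtlas (𝓡 n) ∞ M)
    {v : TangentBundle (𝓡 n) M} (hv : v.1 ∈ φ.source) : tanPoint φ (tanCoords φ v) = v := by
  have h := (mdifferentiable_of_mem_maximalAtlas' hφ).symm_comp_deriv hv
  obtain ⟨x, w⟩ := v
  -- The points `φ.symm (φ x)` and `x` are equal but not definitionally, so their tangent spaces are
  -- different types. Generalising the base point makes substitution possible.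
  have key : ∀ (x' : M) (T : TangentSpace (𝓡 n) x →L[ℝ] TangentSpace (𝓡 n) x'), x' = x →
      (T : EuclideanSpace ℝ (Fin n) →L[ℝ] EuclideanSpace ℝ (Fin n)) =
        ContinuousLinearMap.id ℝ (EuclideanSpace ℝ (Fin n)) →
      (⟨x', T w⟩ : TangentBundle (𝓡 n) M) = ⟨x, w⟩ := by
    rintro x' T rfl hT
    exact congrArg _ (congrArg (fun f => f w) hT)
  exact key (φ.symm (φ x)) ((mfderiv (𝓡 n) (𝓡 n) φ.symm (φ x)).comp (mfderiv (𝓡 n) (𝓡 n) φ x))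
    (φ.left_inv hv) h

end

section

open Bundle Filter
open scoped Manifold ContDiff Topology

variable {n : ℕ} {M : Type*} [TopologicalSpace M] [ChartedSpace (EuclideanSpace ℝ (Fin n)) M]
  [IsManifold (𝓡 n) ∞ M]

/-! ### Induced coordinates on the slit tangent bundle -/

/-- The part of `E` over the domain of a chart of `M`. -/
def chartDom (φ : OpenPartialHomeomorph M (EuclideanSpace ℝ (Fin n))) : Set (slit n M) :=
  {p | p.1.1 ∈ φ.source}

theorem isOpen_chartDom (φ : OpenPartialHomeomorph M (EuclideanSpace ℝ (Fin n))) :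
    IsOpen (chartDom φ) :=
  φ.open_source.preimage (proj n M).contMDiff.continuous

/-- The vector in the fibre of `π^*(TM)` whose components in a chart of `M` are the given ones. -/
def ofComp (φ : OpenPartialHomeomorph M (EuclideanSpace ℝ (Fin n))) (p : slit n M) :
    EuclideanSpace ℝ (Fin n) →L[ℝ] PTM n M p :=
  (mfderiv (𝓡 n) (𝓡 n) φ p.1.1).inverse

/-- The components, in a chart of `M`, of a vector in the fibre of `π^*(TM)`. -/
def toComp (φ : OpenPartialHomeomorph M (EuclideanSpace ℝ (Fin n))) (p : slit n M) :
    PTM n M p →L[ℝ] EuclideanSpace ℝ (Fin n) :=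
  mfderiv (𝓡 n) (𝓡 n) φ p.1.1

/-- The components of a section of `π^*(TM)` in a chart of `M`. -/
def secComp (φ : OpenPartialHomeomorph M (EuclideanSpace ℝ (Fin n))) (u : Sec n M) (p : slit n M) :
    EuclideanSpace ℝ (Fin n) :=
  toComp φ p (u p)

/-- The section of `π^*(TM)` with given components in a chart of `M`. -/
def compSec (φ : OpenPartialHomeomorph M (EuclideanSpace ℝ (Fin n)))
    (f : slit n M → EuclideanSpace ℝ (Fin n)) : Sec n M :=
  fun p => ofComp φ p (f p)

/-- The differential at `p` of the coordinates `(x, y)` of `E`. -/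
def dCoords (φ : OpenPartialHomeomorph M (EuclideanSpace ℝ (Fin n))) (p : slit n M) :
    TangentSpace (IE n) p →L[ℝ] ModelE n :=
  mvfderiv (IE n) (coords φ) p

variable {φ : OpenPartialHomeomorph M (EuclideanSpace ℝ (Fin n))}
  (hφ : φ ∈ IsManifold.maximalAtlas (𝓡 n) ∞ M) {p : slit n M}

include hφ in
theorem toComp_bijective (hp : p ∈ chartDom φ) : Function.Bijective (toComp φ p) :=
  (mdifferentiable_of_mem_maximalAtlas' hφ).mfderiv_bijective hp

include hφ in
theorem ofComp_toComp (hp : p ∈ chartDom φ) (u : PTM n M p) : ofComp φ p (toComp φ p u) = u := by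
  let e := (mdifferentiable_of_mem_maximalAtlas' hφ).mfderiv hp
  have h1 : (mfderiv (𝓡 n) (𝓡 n) φ p.1.1).inverse = (e.symm : _ →L[ℝ] _) :=
    ContinuousLinearMap.inverse_equiv e
  change (mfderiv (𝓡 n) (𝓡 n) φ p.1.1).inverse (e u) = u
  rw [h1]
  exact e.symm_apply_apply u

include hφ in
theorem toComp_ofComp (hp : p ∈ chartDom φ) (v : EuclideanSpace ℝ (Fin n)) :
    toComp φ p (ofComp φ p v) = v := by
  obtain ⟨u, rfl⟩ := (toComp_bijective hφ hp).2 v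
  rw [ofComp_toComp hφ hp]

theorem coords_snd (p : slit n M) : (coords φ p).2 = toComp φ p (liouville p) := rfl

include hφ in
theorem coords_snd_ne (hp : p ∈ chartDom φ) : (coords φ p).2 ≠ 0 := by
  rw [coords_snd]
  intro h
  exact p.2 ((toComp_bijective hφ hp).1 (h.trans (map_zero _).symm))

include hφ in
theorem contMDiffAt_coords (hp : p ∈ chartDom φ) :
    ContMDiffAt (IE n) 𝓘(ℝ, ModelE n) ∞ (coords φ) p :=
  (contMDiffAt_tanCoords hφ hp).comp p contMDiff_subtype_val.contMDiffAt

/-- The point of `E` with given induced coordinates; `p` is a default value. -/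
def slitPoint (φ : OpenPartialHomeomorph M (EuclideanSpace ℝ (Fin n))) (p : slit n M)
    (z : ModelE n) : slit n M :=
  open Classical in if h : (tanPoint φ z).2 ≠ 0 then ⟨tanPoint φ z, h⟩ else p

include hφ in
theorem tanPoint_snd_ne {z : ModelE n} (hz : z.1 ∈ φ.target) (hz' : z.2 ≠ 0) :
    (tanPoint φ z).2 ≠ 0 := by
  intro h
  have h1 := congrArg Prod.snd (tanCoords_tanPoint hφ hz)
  apply hz'
  rw [← h1]
  change mfderiv (𝓡 n) (𝓡 n) φ (tanPoint φ z).1 (tanPoint φ z).2 = 0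
  rw [h]
  exact map_zero _

include hφ in
theorem val_slitPoint {z : ModelE n} (hz : z.1 ∈ φ.target) (hz' : z.2 ≠ 0) :
    (slitPoint φ p z).1 = tanPoint φ z := by
  have h := tanPoint_snd_ne hφ hz hz'
  simp [slitPoint, h]

include hφ in
theorem coords_slitPoint {z : ModelE n} (hz : z.1 ∈ φ.target) (hz' : z.2 ≠ 0) :
    coords φ (slitPoint φ p z) = z := by
  change tanCoords φ (slitPoint φ p z).1 = z
  rw [val_slitPoint hφ hz hz', tanCoords_tanPoint hφ hz]

include hφ in
theorem slitPoint_mem {z : ModelE n} (hz : z.1 ∈ φ.target) (hz' : z.2 ≠ 0) :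
    slitPoint φ p z ∈ chartDom φ := by
  change (slitPoint φ p z).1.1 ∈ φ.source
  rw [val_slitPoint hφ hz hz']
  exact φ.map_target hz

theorem coords_fst_mem (hp : p ∈ chartDom φ) : (coords φ p).1 ∈ φ.target := φ.map_source hp

include hφ in
theorem slitPoint_coords (hp : p ∈ chartDom φ) (q : slit n M) : slitPoint φ q (coords φ p) = p :=
  Subtype.ext ((val_slitPoint hφ (coords_fst_mem hp) (coords_snd_ne hφ hp)).trans
    (tanPoint_tanCoords hφ hp))

theorem isOpen_coordsRange (φ : OpenPartialHomeomorph M (EuclideanSpace ℝ (Fin n))) :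
    IsOpen {z : ModelE n | z.1 ∈ φ.target ∧ z.2 ≠ 0} :=
  (φ.open_target.preimage continuous_fst).inter (isOpen_ne.preimage continuous_snd)

include hφ in
theorem contMDiffAt_slitPoint {z : ModelE n} (hz : z.1 ∈ φ.target) (hz' : z.2 ≠ 0) :
    ContMDiffAt 𝓘(ℝ, ModelE n) (IE n) ∞ (slitPoint φ p) z := by
  refine (ContMDiffAt.subtypeVal_comp_iff _ _ _).1 ?_
  refine (contMDiffAt_tanPoint hφ hz).congr_of_eventuallyEq ?_
  filter_upwards [(isOpen_coordsRange φ).mem_nhds ⟨hz, hz'⟩] with w hw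
  exact val_slitPoint hφ hw.1 hw.2

include hφ in
theorem coords_mem_range (hp : p ∈ chartDom φ) :
    coords φ p ∈ {z : ModelE n | z.1 ∈ φ.target ∧ z.2 ≠ 0} :=
  ⟨coords_fst_mem hp, coords_snd_ne hφ hp⟩

include hφ in
theorem mfderiv_slitPoint_comp (hp : p ∈ chartDom φ) (q : slit n M) (Z : TangentSpace (IE n) p) :
    mfderiv 𝓘(ℝ, ModelE n) (IE n) (slitPoint φ q) (coords φ p)
      (mfderiv (IE n) 𝓘(ℝ, ModelE n) (coords φ) p Z) = (Z : ModelE n) := by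
  obtain ⟨h1, h2⟩ := coords_mem_range hφ hp
  have hc := mfderiv_comp p ((contMDiffAt_slitPoint hφ (p := q) h1 h2).mdifferentiableAt (by simp))
    ((contMDiffAt_coords hφ hp).mdifferentiableAt (by simp))
  have he : slitPoint φ q ∘ coords φ =ᶠ[𝓝 p] id := by
    filter_upwards [(isOpen_chartDom φ).mem_nhds hp] with r hr
    exact slitPoint_coords hφ hr q
  rw [he.mfderiv_eq, mfderiv_id] at hc
  exact (congrArg (fun f => f Z) hc).symm

include hφ in
theorem mfderiv_comp_slitPoint (hp : p ∈ chartDom φ) (q : slit n M) (w : ModelE n) :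
    (mfderiv (IE n) 𝓘(ℝ, ModelE n) (coords φ) p
      (mfderiv 𝓘(ℝ, ModelE n) (IE n) (slitPoint φ q) (coords φ p) w : ModelE n) : ModelE n)
      = w := by
  obtain ⟨h1, h2⟩ := coords_mem_range hφ hp
  have hpq := slitPoint_coords hφ hp q
  have hc := mfderiv_comp (coords φ p)
    (by rw [hpq]; exact (contMDiffAt_coords hφ hp).mdifferentiableAt (by simp))
    ((contMDiffAt_slitPoint hφ (p := q) h1 h2).mdifferentiableAt (by simp))
  have he : coords φ ∘ slitPoint φ q =ᶠ[𝓝 (coords φ p)] id := by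
    filter_upwards [(isOpen_coordsRange φ).mem_nhds ⟨h1, h2⟩] with r hr
    exact coords_slitPoint hφ hr.1 hr.2
  rw [he.mfderiv_eq, mfderiv_id] at hc
  have h3 := (congrArg (fun f => f w) hc).symm
  -- Transports the differential along `slitPoint φ q (coords φ p) = p`, an equality that changes
  -- the type of its domain.
  have h4 : ∀ r : slit n M, r = p → ∀ a : ModelE n,
      (mfderiv (IE n) 𝓘(ℝ, ModelE n) (coords φ) r a : ModelE n) =
      mfderiv (IE n) 𝓘(ℝ, ModelE n) (coords φ) p a := by
    rintro r rfl a
    rfl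
  exact (h4 _ hpq _).symm.trans h3

include hφ in
theorem dCoords_bijective (hp : p ∈ chartDom φ) : Function.Bijective (dCoords φ p) := by
  constructor
  · intro Z Z' h
    have h1 := mfderiv_slitPoint_comp hφ hp p Z
    have h2 := mfderiv_slitPoint_comp hφ hp p Z'
    have h3 : mfderiv (IE n) 𝓘(ℝ, ModelE n) (coords φ) p Z =
      mfderiv (IE n) 𝓘(ℝ, ModelE n) (coords φ) p Z' := h
    rw [h3] at h1
    exact h1.symm.trans h2
  · intro w
    exact ⟨_, mfderiv_comp_slitPoint hφ hp p w⟩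

/-- The differential of the coordinates of `E`, as a continuous linear equivalence. -/
def dCoordsEquiv (hp : p ∈ chartDom φ) : TangentSpace (IE n) p ≃L[ℝ] ModelE n :=
  haveI : FiniteDimensional ℝ (TangentSpace (IE n) p) :=
    inferInstanceAs (FiniteDimensional ℝ (ModelE n))
  haveI : T2Space (TangentSpace (IE n) p) := inferInstanceAs (T2Space (ModelE n))
  (LinearEquiv.ofBijective (dCoords φ p : TangentSpace (IE n) p →ₗ[ℝ] ModelE n)
    (dCoords_bijective hφ hp)).toContinuousLinearEquiv

theorem mvfderiv_comp_coords {F : Type*} [NormedAddCommGroup F] [NormedSpace ℝ F]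
    {f : ModelE n → F} (hφ : φ ∈ IsManifold.maximalAtlas (𝓡 n) ∞ M) (hp : p ∈ chartDom φ)
    (hf : DifferentiableAt ℝ f (coords φ p)) (Z : TangentSpace (IE n) p) :
    mvfderiv (IE n) (fun q => f (coords φ q)) p Z = fderiv ℝ f (coords φ p) (dCoords φ p Z) := by
  have hc := mfderiv_comp p hf.mdifferentiableAt
    ((contMDiffAt_coords hφ hp).mdifferentiableAt (by simp))
  have := congrArg (fun f => f Z) hc
  rw [mfderiv_eq_fderiv] at this
  exact this

include hφ in
theorem dCoords_fst (hp : p ∈ chartDom φ) (Z : TangentSpace (IE n) p) :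
    (dCoords φ p Z).1 = toComp φ p (omega p Z) := by
  have h1 := mvfderiv_comp_coords (f := Prod.fst) hφ hp differentiableAt_fst Z
  rw [fderiv_fst] at h1
  refine Eq.trans h1.symm ?_
  have hc := mfderiv_comp p (I'' := 𝓡 n) (I' := 𝓡 n) (f := proj n M) (g := φ)
    ((mdifferentiable_of_mem_maximalAtlas' hφ).mdifferentiableAt hp)
    ((proj n M).contMDiff.contMDiffAt.mdifferentiableAt (by simp))
  exact congrArg (fun f => f Z) hc

end

section

open Bundle Filter
open scoped Manifold ContDiff Topology

variable {n : ℕ} {M : Type*} [TopologicalSpace M] [ChartedSpace (EuclideanSpace ℝ (Fin n)) M]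
  [IsManifold (𝓡 n) ∞ M]

/-! ### Regularity of sections in components -/

/-- The section `u` of `π^*(TM)` is `C^∞` at `p`. -/
abbrev SmoothSecAt (u : Sec n M) (p : slit n M) : Prop :=
  ContMDiffAt (IE n) ((IE n).prod (𝓡 n)) ∞
    (fun q => TotalSpace.mk' (EuclideanSpace ℝ (Fin n)) q (u q)) p

/-- The section `u` of `π^*(TM)` is differentiable at `p`. -/
abbrev DiffSecAt (u : Sec n M) (p : slit n M) : Prop :=
  MDifferentiableAt (IE n) ((IE n).prod (𝓡 n))
    (fun q => TotalSpace.mk' (EuclideanSpace ℝ (Fin n)) q (u q)) p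

/-- The vector field `X` on `E` is `C^∞` at `p`. -/
abbrev SmoothFieldAt (X : VecField n M) (p : slit n M) : Prop :=
  ContMDiffAt (IE n) (IE n).tangent ∞
    (fun q => (⟨q, X q⟩ : TangentBundle (IE n) (slit n M))) p

variable {φ : OpenPartialHomeomorph M (EuclideanSpace ℝ (Fin n))}
  (hφ : φ ∈ IsManifold.maximalAtlas (𝓡 n) ∞ M) {p : slit n M} {u : Sec n M}

theorem smoothSecAt_iff_tangent : SmoothSecAt u p ↔ ContMDiffAt (IE n) (IE n) ∞
    (fun q => (⟨q.1.1, u q⟩ : TangentBundle (𝓡 n) M)) p := by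
  unfold SmoothSecAt
  rw [Bundle.contMDiffAt_section, Bundle.contMDiffAt_totalSpace]
  exact ⟨fun h => ⟨(proj n M).contMDiff.contMDiffAt, h⟩, fun h => h.2⟩

theorem diffSecAt_iff_tangent : DiffSecAt u p ↔ MDifferentiableAt (IE n) (IE n)
    (fun q => (⟨q.1.1, u q⟩ : TangentBundle (𝓡 n) M)) p := by
  unfold DiffSecAt
  rw [mdifferentiableAt_section, mdifferentiableAt_totalSpace]
  exact ⟨fun h => ⟨(proj n M).contMDiff.contMDiffAt.mdifferentiableAt (by simp), h⟩, fun h => h.2⟩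

include hφ in
theorem smoothSecAt_iff (hp : p ∈ chartDom φ) :
    SmoothSecAt u p ↔ ContMDiffAt (IE n) (𝓡 n) ∞ (secComp φ u) p := by
  rw [smoothSecAt_iff_tangent]
  constructor
  · intro h
    have h1 := (contMDiffAt_tanCoords hφ (v := ⟨p.1.1, u p⟩) hp).comp p h
    exact (contDiff_snd.contMDiff.contMDiffAt (x := tanCoords φ ⟨p.1.1, u p⟩)).comp p h1
  · intro h
    have h0 := (contDiff_fst.contMDiff.contMDiffAt (x := coords φ p)).comp p
      (contMDiffAt_coords hφ hp)
    have h1 := (contMDiffAt_tanPoint hφ (z := (φ p.1.1, secComp φ u p))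
      (φ.map_source hp)).comp p (h0.prodMk_space h)
    refine h1.congr_of_eventuallyEq ?_
    filter_upwards [(isOpen_chartDom φ).mem_nhds hp] with q hq
    exact (tanPoint_tanCoords hφ (v := ⟨q.1.1, u q⟩) hq).symm

include hφ in
theorem diffSecAt_iff (hp : p ∈ chartDom φ) :
    DiffSecAt u p ↔ MDifferentiableAt (IE n) (𝓡 n) (secComp φ u) p := by
  rw [diffSecAt_iff_tangent]
  constructor
  · intro h
    have h1 := ((contMDiffAt_tanCoords hφ (v := ⟨p.1.1, u p⟩) hp).mdifferentiableAt
      (by simp)).comp p h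
    exact (differentiableAt_snd.mdifferentiableAt (x := tanCoords φ ⟨p.1.1, u p⟩)).comp p h1
  · intro h
    have h0 := (differentiableAt_fst.mdifferentiableAt (x := coords φ p)).comp p
      ((contMDiffAt_coords hφ hp).mdifferentiableAt (by simp))
    have h1 := ((contMDiffAt_tanPoint hφ (z := (φ p.1.1, secComp φ u p))
      (φ.map_source hp)).mdifferentiableAt (by simp)).comp p (h0.prodMk_space h)
    refine h1.congr_of_eventuallyEq ?_
    filter_upwards [(isOpen_chartDom φ).mem_nhds hp] with q hq
    exact (tanPoint_tanCoords hφ (v := ⟨q.1.1, u q⟩) hq).symm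

theorem SmoothSecAt.diffSecAt (h : SmoothSecAt u p) : DiffSecAt u p :=
  h.mdifferentiableAt (by simp)

include hφ in
theorem secComp_compSec (hp : p ∈ chartDom φ) (f : slit n M → EuclideanSpace ℝ (Fin n)) :
    secComp φ (compSec φ f) p = f p :=
  toComp_ofComp hφ hp _

include hφ in
theorem smoothSecAt_compSec (hp : p ∈ chartDom φ) {f : slit n M → EuclideanSpace ℝ (Fin n)}
    (hf : ContMDiffAt (IE n) (𝓡 n) ∞ f p) : SmoothSecAt (compSec φ f) p := by
  rw [smoothSecAt_iff hφ hp]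
  refine hf.congr_of_eventuallyEq ?_
  filter_upwards [(isOpen_chartDom φ).mem_nhds hp] with q hq
  exact secComp_compSec hφ hq f

theorem smoothSecAt_liouville (p : slit n M) : SmoothSecAt (liouville (n := n) (M := M)) p := by
  rw [smoothSecAt_iff_tangent]
  exact contMDiff_subtype_val.contMDiffAt

/-! ### Vector fields in coordinates -/

theorem contMDiffAt_mvfderiv_apply {F : Type*} [NormedAddCommGroup F] [NormedSpace ℝ F]
    {f : slit n M → F} {X : VecField n M} (hf : ContMDiffAt (IE n) 𝓘(ℝ, F) ∞ f p)
    (hX : SmoothFieldAt X p) :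
    ContMDiffAt (IE n) 𝓘(ℝ, F) ∞ (fun q => mvfderiv (IE n) f q (X q)) p := by
  have h1 := ContMDiffAt.mfderiv_const hf (m := ∞) le_rfl
  have h2 := ContMDiffAt.clm_apply_of_inCoordinates (b₁ := id) (b₂ := f) (v := X)
    (ϕ := fun q => mfderiv (IE n) 𝓘(ℝ, F) f q) h1 hX hf
  exact ((contMDiff_snd_tangentBundle_modelSpace (n := ∞) F 𝓘(ℝ, F)).contMDiffAt
    (x := ⟨f p, mfderiv (IE n) 𝓘(ℝ, F) f p (X p)⟩)).comp p h2

include hφ in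
theorem contMDiffAt_dCoords_apply (hp : p ∈ chartDom φ) {X : VecField n M}
    (hX : SmoothFieldAt X p) :
    ContMDiffAt (IE n) 𝓘(ℝ, ModelE n) ∞ (fun q => dCoords φ q (X q)) p :=
  contMDiffAt_mvfderiv_apply (contMDiffAt_coords hφ hp) hX

include hφ in
theorem inverse_mfderiv_slitPoint {z : ModelE n} (hz : z.1 ∈ φ.target) (hz' : z.2 ≠ 0)
    (Z : TangentSpace (IE n) (slitPoint φ p z)) :
    (mfderiv 𝓘(ℝ, ModelE n) (IE n) (slitPoint φ p) z).inverse Z =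
      dCoords φ (slitPoint φ p z) Z := by
  have hr := slitPoint_mem hφ (p := p) hz hz'
  have hc := coords_slitPoint hφ (p := p) hz hz'
  have h4 : ∀ z' : ModelE n, z' = z → ∀ a : ModelE n,
      (mfderiv 𝓘(ℝ, ModelE n) (IE n) (slitPoint φ p) z' a : ModelE n) =
      mfderiv 𝓘(ℝ, ModelE n) (IE n) (slitPoint φ p) z a := by
    rintro r rfl a
    rfl
  let e := (dCoordsEquiv hφ hr).symm
  have he : mfderiv 𝓘(ℝ, ModelE n) (IE n) (slitPoint φ p) z = e.toContinuousLinearMap := by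
    ext1 w
    obtain ⟨Z', rfl⟩ := (dCoordsEquiv hφ hr).surjective w
    refine Eq.trans ?_ ((dCoordsEquiv hφ hr).symm_apply_apply Z').symm
    exact (h4 _ hc _).symm.trans (mfderiv_slitPoint_comp hφ hr p Z')
  rw [he]
  exact congrArg (fun f => f Z) (ContinuousLinearMap.inverse_equiv e)

theorem mvfderiv_congr {F : Type*} [NormedAddCommGroup F] [NormedSpace ℝ F]
    {f g : slit n M → F} (h : f =ᶠ[𝓝 p] g) (Z : TangentSpace (IE n) p) :
    mvfderiv (IE n) f p Z = mvfderiv (IE n) g p Z :=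
  congrArg (fun f => f Z) (h.mfderiv_eq (I := IE n) (I' := 𝓘(ℝ, F)))

include hφ in
theorem mvfderiv_eq_fderiv_slitPoint {F : Type*} [NormedAddCommGroup F] [NormedSpace ℝ F]
    {f : slit n M → F} (hp : p ∈ chartDom φ) (hf : MDifferentiableAt (IE n) 𝓘(ℝ, F) f p)
    (Z : TangentSpace (IE n) p) :
    mvfderiv (IE n) f p Z = fderiv ℝ (f ∘ slitPoint φ p) (coords φ p) (dCoords φ p Z) := by
  obtain ⟨h1, h2⟩ := coords_mem_range hφ hp
  have hd : DifferentiableAt ℝ (f ∘ slitPoint φ p) (coords φ p) := by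
    apply MDifferentiableAt.differentiableAt
    refine MDifferentiableAt.comp (coords φ p) (I' := IE n) ?_
      ((contMDiffAt_slitPoint hφ h1 h2).mdifferentiableAt (by simp))
    rwa [slitPoint_coords hφ hp]
  rw [← mvfderiv_comp_coords hφ hp hd]
  apply mvfderiv_congr
  filter_upwards [(isOpen_chartDom φ).mem_nhds hp] with q hq
  simp [slitPoint_coords hφ hq]

theorem mlieBracket_vectorSpace {E : Type*} [NormedAddCommGroup E] [NormedSpace ℝ E]
    (V W : Π x : E, TangentSpace 𝓘(ℝ, E) x) (x : E) :
    VectorField.mlieBracket 𝓘(ℝ, E) V W x =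
      fderiv ℝ (W : E → E) x (V x) - fderiv ℝ (V : E → E) x (W x) := by
  rw [← VectorField.mlieBracketWithin_univ, VectorField.mlieBracketWithin_eq_lieBracketWithin]
  exact congrFun (VectorField.lieBracketWithin_univ (𝕜 := ℝ) (V := (V : E → E))
    (W := (W : E → E))) x

include hφ in
-- The bracket is natural under pullback by `slitPoint`. The pulled-back fields live on the vector
-- space `ModelE n`, where the bracket is the commutator of directional derivatives.
theorem dCoords_mlieBracket (hp : p ∈ chartDom φ) {X Y : VecField n M}
    (hX : SmoothFieldAt X p) (hY : SmoothFieldAt Y p) :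
    dCoords φ p (VectorField.mlieBracket (IE n) X Y p) =
      mvfderiv (IE n) (fun q => dCoords φ q (Y q)) p (X p) -
        mvfderiv (IE n) (fun q => dCoords φ q (X q)) p (Y p) := by
  obtain ⟨h1, h3⟩ := coords_mem_range hφ hp
  have hsp := slitPoint_coords hφ hp p
  have hpull : ∀ W : VecField n M, VectorField.mpullback 𝓘(ℝ, ModelE n) (IE n) (slitPoint φ p) W
      =ᶠ[𝓝 (coords φ p)] (fun q => dCoords φ q (W q)) ∘ slitPoint φ p := by
    intro W
    filter_upwards [(isOpen_coordsRange φ).mem_nhds ⟨h1, h3⟩] with z hz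
    exact inverse_mfderiv_slitPoint hφ hz.1 hz.2 _
  have h2 : minSmoothness ℝ 2 ≤ (∞ : ℕ∞ω) := by
    rw [minSmoothness_of_isRCLikeNormedField]
    exact ENat.LEInfty.out
  have : IsManifold (IE n) (minSmoothness ℝ 2) (slit n M) := IsManifold.of_le h2
  have key := VectorField.mpullback_mlieBracket (I := 𝓘(ℝ, ModelE n)) (I' := IE n)
    (f := slitPoint φ p) (V := X) (W := Y) (x₀ := coords φ p) (n := ∞)
    (by rw [hsp]; exact hX.mdifferentiableAt (by simp))
    (by rw [hsp]; exact hY.mdifferentiableAt (by simp))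
    (contMDiffAt_slitPoint hφ h1 h3) h2
  rw [(hpull _).eq_of_nhds, (hpull X).mlieBracket_vectorField_eq (hpull Y)] at key
  rw [Function.comp_apply, hsp] at key
  have key' := key.trans (mlieBracket_vectorSpace _ _ _)
  rw [key', mvfderiv_eq_fderiv_slitPoint hφ hp
      ((contMDiffAt_dCoords_apply hφ hp hX).mdifferentiableAt (by simp)),
    mvfderiv_eq_fderiv_slitPoint hφ hp
      ((contMDiffAt_dCoords_apply hφ hp hY).mdifferentiableAt (by simp))]
  have hW : ∀ W : VecField n M, dCoords φ (slitPoint φ p (coords φ p))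
      (W (slitPoint φ p (coords φ p))) = dCoords φ p (W p) :=
    fun W => congrArg (fun q => dCoords φ q (W q)) hsp
  simp only [Function.comp_apply]
  rw [hW X, hW Y]

/-- The vector field on `E` with constant components `w` in the coordinates `(x, y)`. -/
def coordField (φ : OpenPartialHomeomorph M (EuclideanSpace ℝ (Fin n))) (w : ModelE n) :
    VecField n M :=
  VectorField.mpullback (IE n) 𝓘(ℝ, ModelE n) (coords φ) (fun _ => w)

include hφ in
theorem dCoords_coordField (hp : p ∈ chartDom φ) (w : ModelE n) :
    dCoords φ p (coordField φ w p) = w := by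
  let e := dCoordsEquiv hφ hp
  have h1 : (mfderiv (IE n) 𝓘(ℝ, ModelE n) (coords φ) p).inverse =
      e.symm.toContinuousLinearMap :=
    ContinuousLinearMap.inverse_equiv e
  change e ((mfderiv (IE n) 𝓘(ℝ, ModelE n) (coords φ) p).inverse w) = w
  rw [h1]
  exact e.apply_symm_apply w

include hφ in
theorem smoothFieldAt_coordField (hp : p ∈ chartDom φ) (w : ModelE n) :
    SmoothFieldAt (coordField φ w) p := by
  refine ContMDiffAt.mpullback_vectorField_preimage (n := ∞) ?_ (contMDiffAt_coords hφ hp) ?_ le_rfl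
  · exact contMDiffAt_vectorSpace_iff_contDiffAt.2 contDiffAt_const
  · exact ⟨dCoordsEquiv hφ hp, rfl⟩

end

section

open Bundle Filter
open scoped Manifold ContDiff Topology

variable {n : ℕ} {M : Type*} [TopologicalSpace M] [ChartedSpace (EuclideanSpace ℝ (Fin n)) M]
  [IsManifold (𝓡 n) ∞ M]

/-! ### Connections in components -/

/-- At `p`, the covariant derivative `cov` has the form `∇_Z u = du(Z) + Γ(ω(Z), u)` in components
with respect to the chart `φ`. -/
def HasChristoffel (φ : OpenPartialHomeomorph M (EuclideanSpace ℝ (Fin n)))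
    (cov : Sec n M → Π p : slit n M, TangentSpace (IE n) p →L[ℝ] PTM n M p) (p : slit n M)
    (Γ : EuclideanSpace ℝ (Fin n) →ₗ[ℝ] EuclideanSpace ℝ (Fin n) →ₗ[ℝ] EuclideanSpace ℝ (Fin n)) :
    Prop :=
  ∀ u : Sec n M, DiffSecAt u p → ∀ Z : TangentSpace (IE n) p,
    toComp φ p (cov u p Z) =
      mvfderiv (IE n) (secComp φ u) p Z + Γ (dCoords φ p Z).1 (secComp φ u p)

/-- The torsion `Dω` of a covariant derivative. -/
def torsionAt (cov : Sec n M → Π p : slit n M, TangentSpace (IE n) p →L[ℝ] PTM n M p)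
    (X Y : VecField n M) (p : slit n M) : PTM n M p :=
  cov (fun q => omega q (Y q)) p (X p) - cov (fun q => omega q (X q)) p (Y p)
    - omega p (VectorField.mlieBracket (IE n) X Y p)

/-- The covariant derivative for which the coordinate frame is parallel. -/
def flatCov (φ : OpenPartialHomeomorph M (EuclideanSpace ℝ (Fin n))) (u : Sec n M) (p : slit n M) :
    TangentSpace (IE n) p →L[ℝ] PTM n M p :=
  (ofComp φ p).comp (mvfderiv (IE n) (secComp φ u) p)

variable {φ : OpenPartialHomeomorph M (EuclideanSpace ℝ (Fin n))}
  (hφ : φ ∈ IsManifold.maximalAtlas (𝓡 n) ∞ M) {p : slit n M}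

theorem secComp_add (u v : Sec n M) : secComp φ (u + v) = secComp φ u + secComp φ v :=
  funext fun q => map_add (toComp φ q) (u q) (v q)

theorem secComp_smul (f : slit n M → ℝ) (u : Sec n M) :
    secComp φ (f • u) = fun q => f q • secComp φ u q :=
  funext fun q => map_smul (toComp φ q) (f q) (u q)

include hφ in
theorem mvfderiv_secComp_smul (hp : p ∈ chartDom φ) {u : Sec n M} (hu : DiffSecAt u p)
    {f : slit n M → ℝ} (hf : MDifferentiableAt (IE n) 𝓘(ℝ, ℝ) f p) (Z : TangentSpace (IE n) p) :
    mvfderiv (IE n) (secComp φ (f • u)) p Z =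
      f p • mvfderiv (IE n) (secComp φ u) p Z + mvfderiv (IE n) f p Z • secComp φ u p := by
  rw [secComp_smul]
  exact congrArg (fun h => h Z) (mvfderiv_smul hf ((diffSecAt_iff hφ hp).1 hu))

include hφ in
theorem mvfderiv_secComp_add (hp : p ∈ chartDom φ) {u v : Sec n M} (hu : DiffSecAt u p)
    (hv : DiffSecAt v p) (Z : TangentSpace (IE n) p) :
    mvfderiv (IE n) (secComp φ (u + v)) p Z =
      mvfderiv (IE n) (secComp φ u) p Z + mvfderiv (IE n) (secComp φ v) p Z := by
  rw [secComp_add]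
  exact congrArg (fun h => h Z)
    (mvfderiv_add ((diffSecAt_iff hφ hp).1 hu) ((diffSecAt_iff hφ hp).1 hv))

include hφ in
theorem isCovariantDerivativeOn_flatCov :
    IsCovariantDerivativeOn (EuclideanSpace ℝ (Fin n)) (flatCov (M := M) φ) (chartDom φ) where
  add {u v p} hu hv hp := by
    ext1 Z
    have := mvfderiv_secComp_add hφ hp hu hv Z
    exact (congrArg (ofComp φ p) this).trans (map_add _ _ _)
  leibniz {u f p} hu hf hp := by
    ext1 Z
    have := mvfderiv_secComp_smul hφ hp hu hf Z
    refine (congrArg (ofComp φ p) this).trans ((map_add _ _ _).trans ?_)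
    rw [map_smul, map_smul]
    exact congrArg (fun w => f p • ofComp φ p (mvfderiv (IE n) (secComp φ u) p Z) +
      mvfderiv (IE n) f p Z • w) (ofComp_toComp hφ hp (u p))

include hφ in
-- The difference of two connections is tensorial. Subtracting the one for which the coordinate
-- frame is parallel leaves a form `A`, whose arguments are the components of the section and of the
-- tangent vector.
theorem exists_connectionForm {s : Set (slit n M)}
    {cov : Sec n M → Π p : slit n M, TangentSpace (IE n) p →L[ℝ] PTM n M p}
    (hcov : IsCovariantDerivativeOn (EuclideanSpace ℝ (Fin n)) cov s) (hs : p ∈ s)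
    (hp : p ∈ chartDom φ) :
    ∃ A : EuclideanSpace ℝ (Fin n) →ₗ[ℝ] ModelE n →ₗ[ℝ] EuclideanSpace ℝ (Fin n),
      ∀ u : Sec n M, DiffSecAt u p → ∀ Z : TangentSpace (IE n) p,
        toComp φ p (cov u p Z) =
          mvfderiv (IE n) (secComp φ u) p Z + A (secComp φ u p) (dCoords φ p Z) := by
  have : ContMDiffVectorBundle 1 (EuclideanSpace ℝ (Fin n)) (PTM n M) (IE n) :=
    ContMDiffVectorBundle.of_le (n := ∞) (by simp)
  have h1 := hcov.mono (Set.inter_subset_left (t := chartDom φ))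
  have h2 := (isCovariantDerivativeOn_flatCov (n := n) (M := M) hφ).mono
    (Set.inter_subset_right (s := s))
  let A := IsCovariantDerivativeOn.difference h1 h2 p
  let e := (dCoordsEquiv hφ hp).symm
  refine ⟨LinearMap.mk₂ ℝ (fun v ζ => toComp φ p (A (ofComp φ p v) (e ζ))) ?_ ?_ ?_ ?_, ?_⟩
  · intro v v' ζ
    simp only [map_add]
    exact map_add (toComp φ p) _ _
  · intro c v ζ
    simp only [map_smul]
    exact map_smul (toComp φ p) _ _
  · intro v ζ ζ'
    simp only [map_add]
  · intro c v ζ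
    simp only [map_smul]
  · intro u hu Z
    have h3 := IsCovariantDerivativeOn.difference_apply h1 h2 ⟨hs, hp⟩ hu
    have h4 : cov u p Z = flatCov φ u p Z + A (u p) Z := by
      have h5 : A (u p) Z = cov u p Z - flatCov φ u p Z := congrArg (fun f => f Z) h3
      exact (add_sub_cancel _ _).symm.trans (congrArg (flatCov φ u p Z + ·) h5.symm)
    have h6 : e (dCoords φ p Z) = Z := (dCoordsEquiv hφ hp).symm_apply_apply Z
    refine (congrArg (toComp φ p) h4).trans ((map_add (toComp φ p) _ _).trans ?_)
    refine congrArg₂ (· + ·) (toComp_ofComp hφ hp _) ?_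
    rw [LinearMap.mk₂_apply, h6]
    exact congrArg (fun w => toComp φ p (A w Z)) (ofComp_toComp hφ hp (u p)).symm

include hφ in
theorem secComp_omega (hp : p ∈ chartDom φ) (X : VecField n M) :
    secComp φ (fun q => omega q (X q)) p = (dCoords φ p (X p)).1 :=
  (dCoords_fst hφ hp (X p)).symm

include hφ in
theorem smoothSecAt_omega (hp : p ∈ chartDom φ) {X : VecField n M} (hX : SmoothFieldAt X p) :
    SmoothSecAt (fun q => omega q (X q)) p := by
  rw [smoothSecAt_iff hφ hp]
  refine ((contDiff_fst.contMDiff.contMDiffAt (x := dCoords φ p (X p))).comp p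
    (contMDiffAt_dCoords_apply hφ hp hX)).congr_of_eventuallyEq ?_
  filter_upwards [(isOpen_chartDom φ).mem_nhds hp] with q hq
  exact secComp_omega hφ hq X

theorem mvfderiv_fst {f : slit n M → ModelE n}
    (hf : MDifferentiableAt (IE n) 𝓘(ℝ, ModelE n) f p) (Z : TangentSpace (IE n) p) :
    mvfderiv (IE n) (fun q => (f q).1) p Z = (mvfderiv (IE n) f p Z).1 := by
  have h1 : DifferentiableAt ℝ (Prod.fst : ModelE n → EuclideanSpace ℝ (Fin n)) (f p) :=
    differentiableAt_fst
  have hc := congrArg (fun f => f Z) (mfderiv_comp p h1.mdifferentiableAt hf)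
  rw [mfderiv_eq_fderiv, fderiv_fst] at hc
  exact hc

include hφ in
/-- The components of the torsion in terms of those of the connection. -/
theorem toComp_torsionAt (hp : p ∈ chartDom φ)
    {cov : Sec n M → Π p : slit n M, TangentSpace (IE n) p →L[ℝ] PTM n M p}
    {A : EuclideanSpace ℝ (Fin n) →ₗ[ℝ] ModelE n →ₗ[ℝ] EuclideanSpace ℝ (Fin n)}
    (hA : ∀ u : Sec n M, DiffSecAt u p → ∀ Z : TangentSpace (IE n) p,
        toComp φ p (cov u p Z) =
          mvfderiv (IE n) (secComp φ u) p Z + A (secComp φ u p) (dCoords φ p Z))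
    {X Y : VecField n M} (hX : SmoothFieldAt X p) (hY : SmoothFieldAt Y p) :
    toComp φ p (torsionAt cov X Y p) =
      A (dCoords φ p (Y p)).1 (dCoords φ p (X p)) - A (dCoords φ p (X p)).1 (dCoords φ p (Y p)) := by
  have key : ∀ {X Y : VecField n M}, SmoothFieldAt Y p →
      toComp φ p (cov (fun q => omega q (Y q)) p (X p)) =
        (mvfderiv (IE n) (fun q => dCoords φ q (Y q)) p (X p)).1 +
          A (dCoords φ p (Y p)).1 (dCoords φ p (X p)) := by
    intro X Y hY
    rw [hA _ (smoothSecAt_omega hφ hp hY).diffSecAt, secComp_omega hφ hp,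
      ← mvfderiv_fst ((contMDiffAt_dCoords_apply hφ hp hY).mdifferentiableAt (by simp))]
    congr 1
    apply mvfderiv_congr
    filter_upwards [(isOpen_chartDom φ).mem_nhds hp] with q hq
    exact secComp_omega hφ hq Y
  -- The derivatives of the components of `X` and `Y` cancel against those in the bracket; only the
  -- algebraic part remains.
  rw [torsionAt, map_sub, map_sub, key hX, key hY, ← dCoords_fst hφ hp,
    dCoords_mlieBracket hφ hp hX hY, Prod.fst_sub]
  abel

include hφ in
theorem exists_christoffel {s : Set (slit n M)}
    {cov : Sec n M → Π p : slit n M, TangentSpace (IE n) p →L[ℝ] PTM n M p}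
    (hcov : IsCovariantDerivativeOn (EuclideanSpace ℝ (Fin n)) cov s) (hs : p ∈ s)
    (hp : p ∈ chartDom φ)
    (htor : ∀ w w', torsionAt cov (coordField φ w) (coordField φ w') p = 0) :
    ∃ Γ : EuclideanSpace ℝ (Fin n) →ₗ[ℝ] EuclideanSpace ℝ (Fin n) →ₗ[ℝ] EuclideanSpace ℝ (Fin n),
      (∀ u v, Γ u v = Γ v u) ∧ HasChristoffel φ cov p Γ := by
  obtain ⟨A, hA⟩ := exists_connectionForm hφ hcov hs hp
  -- With `w` vertical the right side is `A 0 w' = 0`, so `A` vanishes on vertical vectors; with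
  -- both horizontal this is the symmetry of `Γ`.
  have hsymm : ∀ w w' : ModelE n, A w'.1 w = A w.1 w' := by
    intro w w'
    have h := toComp_torsionAt hφ hp hA (smoothFieldAt_coordField hφ hp w)
      (smoothFieldAt_coordField hφ hp w')
    rw [htor, map_zero,
      dCoords_coordField hφ hp, dCoords_coordField hφ hp] at h
    exact sub_eq_zero.1 h.symm
  refine ⟨(A.compl₂ (LinearMap.inl ℝ _ _)).flip, fun u v => ?_, fun u hu Z => ?_⟩
  · exact hsymm (u, 0) (v, 0)
  · rw [hA u hu]
    congr 1
    -- Both instances have the same right side, so only the horizontal part of `dCoords φ p Z`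
    -- matters to `A`.
    have h := hsymm (dCoords φ p Z) (secComp φ u p, 0)
    have h' := hsymm ((dCoords φ p Z).1, 0) (secComp φ u p, 0)
    exact h.trans (h'.symm.trans rfl |>.symm ▸ rfl)

include hφ in
theorem torsionAt_eq_zero (hp : p ∈ chartDom φ)
    {cov : Sec n M → Π p : slit n M, TangentSpace (IE n) p →L[ℝ] PTM n M p}
    {Γ : EuclideanSpace ℝ (Fin n) →ₗ[ℝ] EuclideanSpace ℝ (Fin n) →ₗ[ℝ] EuclideanSpace ℝ (Fin n)}
    (hΓ : HasChristoffel φ cov p Γ) (hsymm : ∀ u v, Γ u v = Γ v u)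
    {X Y : VecField n M} (hX : SmoothFieldAt X p) (hY : SmoothFieldAt Y p) :
    torsionAt cov X Y p = 0 := by
  apply (toComp_bijective hφ hp).1
  rw [map_zero, toComp_torsionAt hφ hp (A := (Γ.comp (LinearMap.fst ℝ _ _)).flip) hΓ hX hY]
  exact sub_eq_zero.2 (hsymm _ _)

/-! ### The covariant derivative of a metric in components -/

/-- `(∇_Z g)(u, v)`. -/
def metricDeriv (cov : Sec n M → Π p : slit n M, TangentSpace (IE n) p →L[ℝ] PTM n M p)
    (g : PullbackMetric n M) (u v : Sec n M) (p : slit n M) (Z : TangentSpace (IE n) p) : ℝ :=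
  mvfderiv (IE n) (fun q => g.toFun q (u q) (v q)) p Z - g.toFun p (cov u p Z) (v p) -
    g.toFun p (u p) (cov v p Z)

/-- The components of `y` are the fibre coordinates, so their differential along `Z` is the second
part of `dCoords φ p Z`. Hence `∇y` is the identity on vertical vectors and vanishes exactly on the
vectors `(ξ, -Γ(ξ, y))`. -/
theorem HasChristoffel.toComp_liouville
    {cov : Sec n M → Π p : slit n M, TangentSpace (IE n) p →L[ℝ] PTM n M p}
    {Γ : EuclideanSpace ℝ (Fin n) →ₗ[ℝ] EuclideanSpace ℝ (Fin n) →ₗ[ℝ] EuclideanSpace ℝ (Fin n)}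
    (hΓ : HasChristoffel φ cov p Γ) (hφ : φ ∈ IsManifold.maximalAtlas (𝓡 n) ∞ M)
    (hp : p ∈ chartDom φ) (Z : TangentSpace (IE n) p) :
    toComp φ p (cov liouville p Z) =
      (dCoords φ p Z).2 + Γ (dCoords φ p Z).1 (coords φ p).2 := by
  rw [hΓ _ (smoothSecAt_liouville p).diffSecAt]
  congr 1
  have h1 := mvfderiv_comp_coords (f := Prod.snd) hφ hp differentiableAt_snd Z
  rw [fderiv_snd] at h1
  exact h1

/-- After transport to `ModelE n` by `slitPoint` the usual product rule applies. The derivatives of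
the components of `u` and `v` cancel against those in `∇u` and `∇v`, leaving an expression that is
tensorial in both sections. -/
theorem HasChristoffel.metricDeriv_eq
    {cov : Sec n M → Π p : slit n M, TangentSpace (IE n) p →L[ℝ] PTM n M p}
    {Γ : EuclideanSpace ℝ (Fin n) →ₗ[ℝ] EuclideanSpace ℝ (Fin n) →ₗ[ℝ] EuclideanSpace ℝ (Fin n)}
    (hΓ : HasChristoffel φ cov p Γ) (hφ : φ ∈ IsManifold.maximalAtlas (𝓡 n) ∞ M)
    (hp : p ∈ chartDom φ) {g : PullbackMetric n M} {B : ModelE n → EuclideanSpace ℝ (Fin n) →L[ℝ]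
      EuclideanSpace ℝ (Fin n) →L[ℝ] ℝ} (hB : DifferentiableAt ℝ B (coords φ p))
    (hg : ∀ q ∈ chartDom φ, ∀ u v, g.toFun q u v = B (coords φ q) (toComp φ q u) (toComp φ q v))
    {u v : Sec n M} (hu : DiffSecAt u p) (hv : DiffSecAt v p) (Z : TangentSpace (IE n) p) :
    metricDeriv cov g u v p Z =
      fderiv ℝ B (coords φ p) (dCoords φ p Z) (secComp φ u p) (secComp φ v p) -
        B (coords φ p) (Γ (dCoords φ p Z).1 (secComp φ u p)) (secComp φ v p) -
        B (coords φ p) (secComp φ u p) (Γ (dCoords φ p Z).1 (secComp φ v p)) := by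
  have h1 : mvfderiv (IE n) (fun q => g.toFun q (u q) (v q)) p Z =
      mvfderiv (IE n) (fun q => B (coords φ q) (secComp φ u q) (secComp φ v q)) p Z := by
    apply mvfderiv_congr
    filter_upwards [(isOpen_chartDom φ).mem_nhds hp] with q hq using hg q hq _ _
  have hu' := (diffSecAt_iff hφ hp).1 hu
  have hv' := (diffSecAt_iff hφ hp).1 hv
  have h2 : mvfderiv (IE n) (fun q => B (coords φ q) (secComp φ u q) (secComp φ v q)) p Z =
      fderiv ℝ B (coords φ p) (dCoords φ p Z) (secComp φ u p) (secComp φ v p) +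
      B (coords φ p) (mvfderiv (IE n) (secComp φ u) p Z) (secComp φ v p) +
      B (coords φ p) (secComp φ u p) (mvfderiv (IE n) (secComp φ v) p Z) := by
    obtain ⟨hz, hz'⟩ := coords_mem_range hφ hp
    have hB' : DifferentiableAt ℝ B (coords φ p) := hB
    have hd : ∀ {a : slit n M → EuclideanSpace ℝ (Fin n)}, MDifferentiableAt (IE n) (𝓡 n) a p →
        DifferentiableAt ℝ (a ∘ slitPoint φ p) (coords φ p) := by
      intro a ha
      apply MDifferentiableAt.differentiableAt
      refine MDifferentiableAt.comp (coords φ p) (I' := IE n) ?_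
        ((contMDiffAt_slitPoint hφ hz hz').mdifferentiableAt (by simp))
      rwa [slitPoint_coords hφ hp]
    have hda := hd hu'
    have hdb := hd hv'
    have h3 : (fun q => B (coords φ q) (secComp φ u q) (secComp φ v q)) =ᶠ[𝓝 p]
        fun q => (fun z => B z ((secComp φ u ∘ slitPoint φ p) z)
          ((secComp φ v ∘ slitPoint φ p) z)) (coords φ q) := by
      filter_upwards [(isOpen_chartDom φ).mem_nhds hp] with q hq
      simp [slitPoint_coords hφ hq]
    rw [mvfderiv_congr h3, mvfderiv_comp_coords hφ hp ((hB.clm_apply hda).clm_apply hdb),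
      fderiv_clm_apply (hB.clm_apply hda) hdb, fderiv_clm_apply hB hda,
      mvfderiv_eq_fderiv_slitPoint hφ hp hu', mvfderiv_eq_fderiv_slitPoint hφ hp hv']
    simp only [Function.comp_apply, slitPoint_coords hφ hp]
    simp only [add_apply, ContinuousLinearMap.comp_apply, ContinuousLinearMap.flip_apply]
    ring
  rw [metricDeriv, h1, h2, hg p hp, hg p hp, hΓ u hu, hΓ v hv, map_add, map_add]
  change _ - (B (coords φ p) (mvfderiv (IE n) (secComp φ u) p Z) (secComp φ v p) +
    B (coords φ p) (Γ (dCoords φ p Z).1 (secComp φ u p)) (secComp φ v p)) - _ = _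
  change _ - _ - (B (coords φ p) (secComp φ u p) (mvfderiv (IE n) (secComp φ v) p Z) +
    B (coords φ p) (secComp φ u p) (Γ (dCoords φ p Z).1 (secComp φ v p))) = _
  ring

end

section

open Bundle Filter
open scoped Manifold ContDiff Topology

variable {n : ℕ} {M : Type*} [TopologicalSpace M] [ChartedSpace (EuclideanSpace ℝ (Fin n)) M]
  [IsManifold (𝓡 n) ∞ M]

variable {φ : OpenPartialHomeomorph M (EuclideanSpace ℝ (Fin n))}
  (hφ : φ ∈ IsManifold.maximalAtlas (𝓡 n) ∞ M) {p : slit n M}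

/-! ### Lagrangians in coordinates -/

theorem PullbackMetric.contMDiffAt_apply (g : PullbackMetric n M) {u v : Sec n M}
    (hu : SmoothSecAt u p) (hv : SmoothSecAt v p) :
    ContMDiffAt (IE n) 𝓘(ℝ, ℝ) ∞ (fun q => g.toFun q (u q) (v q)) p := by
  have h := ContMDiffAt.clm_bundle_apply₂ (E₃ := Bundle.Trivial (slit n M) ℝ) (F₃ := ℝ)
    (b := fun q : slit n M => q) (ψ := g.toFun) (g.smooth p) hu hv
  rw [Bundle.contMDiffAt_section] at h
  exact h

theorem inCoords_tanCoords (hφ : φ ∈ IsManifold.maximalAtlas (𝓡 n) ∞ M)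
    (L : TangentBundle (𝓡 n) M → ℝ) {v : TangentBundle (𝓡 n) M} (hv : v.1 ∈ φ.source) :
    inCoords φ L (tanCoords φ v) = L v :=
  congrArg L (tanPoint_tanCoords hφ hv)

theorem inCoords_coords (hφ : φ ∈ IsManifold.maximalAtlas (𝓡 n) ∞ M)
    (L : TangentBundle (𝓡 n) M → ℝ) (hp : p ∈ chartDom φ) :
    inCoords φ L (coords φ p) = L p.1 :=
  inCoords_tanCoords hφ L hp

/-- The range of the coordinates of `E` induced by a chart. -/
abbrev coordsRange (φ : OpenPartialHomeomorph M (EuclideanSpace ℝ (Fin n))) : Set (ModelE n) :=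
  {z | z.1 ∈ φ.target ∧ z.2 ≠ 0}

include hφ in
theorem exists_coords_eq {z : ModelE n} (hz : z ∈ coordsRange φ) :
    ∃ p ∈ chartDom φ, coords φ p = z := by
  let p : slit n M := ⟨tanPoint φ z, tanPoint_snd_ne hφ hz.1 hz.2⟩
  exact ⟨slitPoint φ p z, slitPoint_mem hφ hz.1 hz.2, coords_slitPoint hφ hz.1 hz.2⟩

include hφ in
theorem contDiffOn_inCoords {L : TangentBundle (𝓡 n) M → ℝ}
    (hL : ContMDiffOn (IE n) 𝓘(ℝ, ℝ) ∞ L {p : TangentBundle (𝓡 n) M | p.2 ≠ 0}) :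
    ContDiffOn ℝ ∞ (inCoords φ L) (coordsRange φ) := by
  intro z hz
  have h1 : ContMDiffAt (IE n) 𝓘(ℝ, ℝ) ∞ L (tanPoint φ z) :=
    hL.contMDiffAt ((isOpen_slit n M).mem_nhds (tanPoint_snd_ne hφ hz.1 hz.2))
  exact (h1.comp z (contMDiffAt_tanPoint hφ hz.1)).contDiffAt.contDiffWithinAt

theorem tanCoords_smul (φ : OpenPartialHomeomorph M (EuclideanSpace ℝ (Fin n))) (x : M)
    (y : TangentSpace (𝓡 n) x) (s : ℝ) :
    tanCoords φ ⟨x, s • y⟩ = ((tanCoords φ ⟨x, y⟩).1, s • (tanCoords φ ⟨x, y⟩).2) :=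
  Prod.ext rfl (map_smul (mfderiv (𝓡 n) (𝓡 n) φ x) s y)

theorem tanCoords_add_smul (φ : OpenPartialHomeomorph M (EuclideanSpace ℝ (Fin n))) (x : M)
    (y u v : TangentSpace (𝓡 n) x) (r s : ℝ) :
    tanCoords φ ⟨x, y + r • u + s • v⟩ = ((tanCoords φ ⟨x, y⟩).1, (tanCoords φ ⟨x, y⟩).2 +
      r • (tanCoords φ ⟨x, u⟩).2 + s • (tanCoords φ ⟨x, v⟩).2) := by
  refine Prod.ext rfl ?_
  let A := mfderiv (𝓡 n) (𝓡 n) φ x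
  change A (y + r • u + s • v) = A y + r • A u + s • A v
  rw [map_add, map_add, map_smul, map_smul]

include hφ in
theorem deriv_deriv_eq_vertHess_inCoords {L : TangentBundle (𝓡 n) M → ℝ}
    (hL : ContMDiffOn (IE n) 𝓘(ℝ, ℝ) ∞ L {p : TangentBundle (𝓡 n) M | p.2 ≠ 0})
    (hp : p ∈ chartDom φ) (u v : TangentSpace (𝓡 n) (p.1.1 : M)) :
    deriv (fun r : ℝ => deriv (fun s : ℝ => L ⟨p.1.1, p.1.2 + r • u + s • v⟩) 0) 0 =
      vertHess (inCoords φ L) (coords φ p) (toComp φ p u) (toComp φ p v) := by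
  rw [← deriv_deriv_eq_vertHess (isOpen_coordsRange φ) (contDiffOn_inCoords hφ hL)
    (coords_mem_range hφ hp)]
  congr 1
  funext r
  congr 1
  funext s
  refine (inCoords_tanCoords hφ L (v := ⟨p.1.1, p.1.2 + r • u + s • v⟩) hp).symm.trans ?_
  exact congrArg (inCoords φ L) (tanCoords_add_smul φ p.1.1 p.1.2 u v r s)

include hφ in
theorem IsVerticalHessian.apply_eq {g : PullbackMetric n M} {L : TangentBundle (𝓡 n) M → ℝ}
    (hg : IsVerticalHessian g L) (hL : IsLagrangian L) (hp : p ∈ chartDom φ) (u v : PTM n M p) :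
    g.toFun p u v = vertHess (inCoords φ L) (coords φ p) (toComp φ p u) (toComp φ p v) :=
  (hg p u v).trans (deriv_deriv_eq_vertHess_inCoords hφ hL.smooth hp u v)

include hφ in
theorem isLocalLagrangian_inCoords {g : PullbackMetric n M} {L : TangentBundle (𝓡 n) M → ℝ}
    (hg : IsVerticalHessian g L) (hL : IsLagrangian L) :
    IsLocalLagrangian (inCoords φ L) (coordsRange φ) where
  isOpen := isOpen_coordsRange φ
  contDiffOn := contDiffOn_inCoords hφ hL.smooth
  euler z hz := by
    obtain ⟨p, hp, rfl⟩ := exists_coords_eq hφ hz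
    refine euler_of_homogeneous (differentiableAt_of_mem (isOpen_coordsRange φ)
      (contDiffOn_inCoords hφ hL.smooth) hz) fun s hs => ?_
    have h1 := hL.homogeneous p.1.1 p.1.2 p.2 s hs
    rw [← inCoords_tanCoords hφ L (v := ⟨p.1.1, s • p.1.2⟩) hp,
      ← inCoords_tanCoords hφ L (v := ⟨p.1.1, p.1.2⟩) hp] at h1
    exact (congrArg (inCoords φ L) (tanCoords_smul φ p.1.1 p.1.2 s)).symm.trans h1
  nondegenerate z hz u hu := by
    obtain ⟨p, hp, rfl⟩ := exists_coords_eq hφ hz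
    have h1 : ofComp φ p u = 0 := by
      refine g.nondegenerate p _ fun v => ?_
      rw [hg.apply_eq hφ hL hp, toComp_ofComp hφ hp]
      exact hu _
    rw [← toComp_ofComp hφ hp u, h1, map_zero]

/-! ### The Lagrangian of a metric with a connection -/

/-- The function `g(y, y) / 2`, extended by zero to the zero section. -/
def lagrangianOf (g : PullbackMetric n M) (v : TangentBundle (𝓡 n) M) : ℝ :=
  open Classical in
  if h : v.2 ≠ 0 then (1 / 2) * g.toFun ⟨v, h⟩ (liouville ⟨v, h⟩) (liouville ⟨v, h⟩) else 0

theorem lagrangianOf_val (g : PullbackMetric n M) (p : slit n M) :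
    lagrangianOf g p.1 = (1 / 2) * g.toFun p (liouville p) (liouville p) := by
  have h : p.1.2 ≠ 0 := p.2
  simp [lagrangianOf, h]

theorem contMDiffOn_lagrangianOf (g : PullbackMetric n M) :
    ContMDiffOn (IE n) 𝓘(ℝ, ℝ) ∞ (lagrangianOf g) {p : TangentBundle (𝓡 n) M | p.2 ≠ 0} := by
  intro v hv
  apply ContMDiffAt.contMDiffWithinAt
  refine (contMDiffAt_subtype_iff (U := slit n M) (x := ⟨v, hv⟩)).1 ?_
  have h1 := g.contMDiffAt_apply (smoothSecAt_liouville ⟨v, hv⟩) (smoothSecAt_liouville ⟨v, hv⟩)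
  have h2 : ContMDiffAt (IE n) 𝓘(ℝ, ℝ) ∞
      (fun q => (1 / 2) * g.toFun q (liouville q) (liouville q)) (⟨v, hv⟩ : slit n M) :=
    (contDiff_const.mul contDiff_id).contMDiff.contMDiffAt.comp _ h1
  exact h2.congr_of_eventuallyEq (Eventually.of_forall (lagrangianOf_val g))

end

/-! ### Vector fields and sections with constant components. -/

section

open Bundle Filter
open scoped Manifold ContDiff Topology

variable {n : ℕ} {M : Type*} [TopologicalSpace M] [ChartedSpace (EuclideanSpace ℝ (Fin n)) M]
  [IsManifold (𝓡 n) ∞ M]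

variable {φ : OpenPartialHomeomorph M (EuclideanSpace ℝ (Fin n))}
  (hφ : φ ∈ IsManifold.maximalAtlas (𝓡 n) ∞ M) {p : slit n M}

include hφ in
theorem smoothFieldOn_coordField (w : ModelE n) :
    SmoothFieldOn (M := M) (chartDom φ) (coordField φ w) :=
  fun _ hq => (smoothFieldAt_coordField hφ hq w).contMDiffWithinAt

include hφ in
theorem smoothSecAt_compSec_const (hp : p ∈ chartDom φ) (u : EuclideanSpace ℝ (Fin n)) :
    SmoothSecAt (compSec (M := M) φ fun _ => u) p :=
  smoothSecAt_compSec hφ hp contMDiffAt_const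

include hφ in
theorem smoothSecOn_compSec_const (u : EuclideanSpace ℝ (Fin n)) :
    SmoothSecOn (M := M) (chartDom φ) (compSec φ fun _ => u) :=
  fun _ hq => (smoothSecAt_compSec_const hφ hq u).contMDiffWithinAt

include hφ in
theorem mvfderiv_secComp_compSec_const (hp : p ∈ chartDom φ) (u : EuclideanSpace ℝ (Fin n))
    (Z : TangentSpace (IE n) p) :
    mvfderiv (IE n) (secComp φ (compSec (M := M) φ fun _ => u)) p Z = 0 := by
  have h : secComp φ (compSec (M := M) φ fun _ => u) =ᶠ[𝓝 p] fun _ => u := by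
    filter_upwards [(isOpen_chartDom φ).mem_nhds hp] with q hq
    exact secComp_compSec hφ hq _
  rw [mvfderiv_congr h, mvfderiv_const]
  rfl

theorem smoothSecOn_liouville (U : Set (slit n M)) : SmoothSecOn U liouville :=
  fun q _ => (smoothSecAt_liouville q).contMDiffWithinAt

/-! ### The Lagrangian forced by `T = 0` and `y · Dg = 0`. -/

namespace FinslerConnection

variable {D : FinslerConnection n M} {g : PullbackMetric n M}

theorem smoothSecOn_nabla (D : FinslerConnection n M) {U : Set (slit n M)} (hU : IsOpen U)
    {X : VecField n M} {u : Sec n M} (hX : SmoothFieldOn U X) (hu : SmoothSecOn U u) :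
    SmoothSecOn U (D.nabla X u) :=
  ContMDiffOn.clm_bundle_apply (b := fun q : slit n M => q) (E₁ := TangentSpace (IE n))
    (F₁ := ModelE n) ((D.smooth U hU).contMDiff hu) hX

include hφ in
theorem exists_christoffel (hD : D.TorsionFree) (hp : p ∈ chartDom φ) :
    ∃ Γ : EuclideanSpace ℝ (Fin n) →ₗ[ℝ] EuclideanSpace ℝ (Fin n) →ₗ[ℝ] EuclideanSpace ℝ (Fin n),
      (∀ u v, Γ u v = Γ v u) ∧ HasChristoffel φ D.cov.toFun p Γ :=
  FinslerGeometry.exists_christoffel hφ D.cov.isCovariantDerivativeOnUniv (Set.mem_univ p) hp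
    fun w w' => hD _ (isOpen_chartDom φ) _ _ (smoothFieldOn_coordField hφ w)
      (smoothFieldOn_coordField hφ w') p hp

include hφ in
theorem cov_liouville_vertical (hD : D.TorsionFree) (hp : p ∈ chartDom φ)
    (w : EuclideanSpace ℝ (Fin n)) :
    D.cov liouville p (coordField φ (0, w) p) = ofComp φ p w := by
  obtain ⟨Γ, -, hΓ⟩ := exists_christoffel hφ hD hp
  apply (toComp_bijective hφ hp).1
  rw [hΓ.toComp_liouville hφ hp, dCoords_coordField hφ hp, toComp_ofComp hφ hp]
  simp

include hφ in
theorem cov_compSec_const_vertical (hD : D.TorsionFree) (hp : p ∈ chartDom φ)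
    (u w : EuclideanSpace ℝ (Fin n)) :
    D.cov (compSec φ fun _ => u) p (coordField φ (0, w) p) = 0 := by
  obtain ⟨Γ, -, hΓ⟩ := exists_christoffel hφ hD hp
  apply (toComp_bijective hφ hp).1
  rw [hΓ _ (smoothSecAt_compSec_const hφ hp u).diffSecAt, dCoords_coordField hφ hp,
    mvfderiv_secComp_compSec_const hφ hp]
  simp

include hφ in
-- Condition (γ) with `v = y`: the derivative of `g(y, y)` along a vertical `w` is `2 g(∇_w y, y)`,
-- and `∇_w y = w`.
theorem fderiv_lagrangianOf (hD : D.TorsionFree) (hg : D.YDgZero g) (hp : p ∈ chartDom φ)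
    (w : EuclideanSpace ℝ (Fin n)) :
    fderiv ℝ (inCoords φ (lagrangianOf g)) (coords φ p) (0, w) =
      g.toFun p (liouville p) (ofComp φ p w) := by
  have h1 : metricDeriv D.cov.toFun g liouville liouville p (coordField φ (0, w) p) = 0 :=
    hg _ (isOpen_chartDom φ) _ _ (smoothFieldOn_coordField hφ (0, w)) (smoothSecOn_liouville _) p hp
  have hl := differentiableAt_of_mem (isOpen_coordsRange φ)
    (contDiffOn_inCoords hφ (contMDiffOn_lagrangianOf g)) (coords_mem_range hφ hp)
  have h2 : (fun q => g.toFun q (liouville q) (liouville q)) =ᶠ[𝓝 p]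
      fun q => (fun z => 2 * inCoords φ (lagrangianOf g) z) (coords φ q) := by
    filter_upwards [(isOpen_chartDom φ).mem_nhds hp] with q hq
    rw [inCoords_coords hφ _ hq, lagrangianOf_val]
    ring
  rw [metricDeriv, mvfderiv_congr h2, mvfderiv_comp_coords hφ hp (hl.const_mul 2),
    dCoords_coordField hφ hp, cov_liouville_vertical hφ hD hp, fderiv_const_mul hl,
    g.symm p (ofComp φ p w)] at h1
  change 2 * fderiv ℝ (inCoords φ (lagrangianOf g)) (coords φ p) (0, w) - _ - _ = 0 at h1
  linarith

include hφ in
-- Condition (γ) applied to `g(y, u)`, which is the first vertical derivative by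
-- `fderiv_lagrangianOf`. The section `u` with constant components is parallel in vertical
-- directions, so only `g(∇_w y, u) = g(w, u)` survives.
theorem vertHess_lagrangianOf (hD : D.TorsionFree) (hg : D.YDgZero g) (hp : p ∈ chartDom φ)
    (u w : EuclideanSpace ℝ (Fin n)) :
    vertHess (inCoords φ (lagrangianOf g)) (coords φ p) w u =
      g.toFun p (ofComp φ p w) (ofComp φ p u) := by
  have h1 : metricDeriv D.cov.toFun g liouville (compSec φ fun _ => u) p
      (coordField φ (0, w) p) = 0 :=
    hg _ (isOpen_chartDom φ) _ _ (smoothFieldOn_coordField hφ (0, w))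
      (smoothSecOn_compSec_const hφ u) p hp
  have hl := differentiableAt_fderiv (isOpen_coordsRange φ)
    (contDiffOn_inCoords hφ (contMDiffOn_lagrangianOf g)) (coords_mem_range hφ hp)
  have h2 : (fun q => g.toFun q (liouville q) (compSec φ (fun _ => u) q)) =ᶠ[𝓝 p]
      fun q => (fun z => fderiv ℝ (inCoords φ (lagrangianOf g)) z (0, u)) (coords φ q) := by
    filter_upwards [(isOpen_chartDom φ).mem_nhds hp] with q hq
    exact (fderiv_lagrangianOf hφ hD hg hq u).symm
  rw [metricDeriv, mvfderiv_congr h2,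
    mvfderiv_comp_coords hφ hp (hl.clm_apply (differentiableAt_const _)),
    dCoords_coordField hφ hp, cov_liouville_vertical hφ hD hp,
    cov_compSec_const_vertical hφ hD hp, fderiv_fderiv_apply hl, map_zero, sub_zero] at h1
  exact sub_eq_zero.1 h1

theorem isVerticalHessian_lagrangianOf (hD : D.TorsionFree) (hg : D.YDgZero g) :
    IsVerticalHessian g (lagrangianOf g) := by
  intro p u v
  have hφ := IsManifold.chart_mem_maximalAtlas (I := 𝓡 n) (n := ∞) (p.1.1 : M)
  have hp : p ∈ chartDom (chartAt (EuclideanSpace ℝ (Fin n)) (p.1.1 : M)) := mem_chart_source _ _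
  refine Eq.trans ?_ (deriv_deriv_eq_vertHess_inCoords hφ (contMDiffOn_lagrangianOf g) hp u v).symm
  rw [vertHess_lagrangianOf hφ hD hg hp]
  exact congrArg₂ (fun a b => g.toFun p a b) (ofComp_toComp hφ hp u).symm
    (ofComp_toComp hφ hp v).symm

theorem isLagrangian_lagrangianOf (hD : D.TorsionFree) (hg : D.YDgZero g) :
    IsLagrangian (lagrangianOf g) where
  smooth := contMDiffOn_lagrangianOf g
  homogeneous x y hy s hs := by
    have hφ := IsManifold.chart_mem_maximalAtlas (I := 𝓡 n) (n := ∞) x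
    set φ := chartAt (EuclideanSpace ℝ (Fin n)) x
    have hx : x ∈ φ.source := mem_chart_source _ _
    let p : slit n M := ⟨⟨x, y⟩, hy⟩
    have hp : p ∈ chartDom φ := hx
    obtain ⟨h1, h2⟩ := coords_mem_range hφ hp
    have hmem : ∀ s : ℝ, 0 < s → ((coords φ p).1, s • (coords φ p).2) ∈ coordsRange φ :=
      fun s hs => ⟨h1, smul_ne_zero hs.ne' h2⟩
    have h3 := homogeneous_of_euler (l := inCoords φ (lagrangianOf g)) (z := coords φ p)
      (fun s hs => differentiableAt_of_mem (isOpen_coordsRange φ)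
        (contDiffOn_inCoords hφ (contMDiffOn_lagrangianOf g)) (hmem s hs)) ?_ hs
    · rw [inCoords_coords hφ _ hp] at h3
      refine Eq.trans ?_ h3
      refine (inCoords_tanCoords hφ (lagrangianOf g) (v := ⟨x, s • y⟩) hx).symm.trans ?_
      exact congrArg (inCoords φ (lagrangianOf g)) (tanCoords_smul φ x y s)
    · intro s hs
      obtain ⟨q, hq, hqs⟩ := exists_coords_eq hφ (hmem s hs)
      -- In the direction `w = y` the first-derivative formula is Euler's relation, its right side
      -- being `g(y, y) = 2L`.
      have h4 := fderiv_lagrangianOf hφ hD hg hq (coords φ q).2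
      rw [coords_snd, ofComp_toComp hφ hq, ← coords_snd] at h4
      rw [hqs] at h4
      rw [h4, ← hqs, inCoords_coords hφ _ hq, lagrangianOf_val]
      ring

/-! ### Characterization of the Chern connection -/

end FinslerConnection

/-- The components of the covariant derivative of a metric with components `B`. -/
def metricDerivComp (B : ModelE n → EuclideanSpace ℝ (Fin n) →L[ℝ] EuclideanSpace ℝ (Fin n) →L[ℝ] ℝ)
    (Γ : EuclideanSpace ℝ (Fin n) →ₗ[ℝ] EuclideanSpace ℝ (Fin n) →ₗ[ℝ] EuclideanSpace ℝ (Fin n))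
    (z ζ : ModelE n) (u v : EuclideanSpace ℝ (Fin n)) : ℝ :=
  fderiv ℝ B z ζ u v - B z (Γ ζ.1 u) v - B z u (Γ ζ.1 v)

namespace FinslerConnection

variable {D : FinslerConnection n M} {g : PullbackMetric n M} {L : TangentBundle (𝓡 n) M → ℝ}
  {Γ : EuclideanSpace ℝ (Fin n) →ₗ[ℝ] EuclideanSpace ℝ (Fin n) →ₗ[ℝ] EuclideanSpace ℝ (Fin n)}

include hφ in
theorem metricDeriv_eq_comp (hg : IsVerticalHessian g L) (hL : IsLagrangian L)
    (hp : p ∈ chartDom φ)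
    {cov : Sec n M → Π p : slit n M, TangentSpace (IE n) p →L[ℝ] PTM n M p}
    (hΓ : HasChristoffel φ cov p Γ) {u v : Sec n M} (hu : DiffSecAt u p) (hv : DiffSecAt v p)
    (Z : TangentSpace (IE n) p) :
    metricDeriv cov g u v p Z = metricDerivComp (vertHess (inCoords φ L)) Γ (coords φ p)
      (dCoords φ p Z) (secComp φ u p) (secComp φ v p) :=
  hΓ.metricDeriv_eq hφ hp (differentiableAt_vertHess (isOpen_coordsRange φ)
    (contDiffOn_inCoords hφ hL.smooth) (coords_mem_range hφ hp))
    (fun _ hq u v => hg.apply_eq hφ hL hq u v) hu hv Z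

include hφ in
theorem dgWedgeDy_eq (hg : IsVerticalHessian g L) (hL : IsLagrangian L)
    (hp : p ∈ chartDom φ) (hΓ : HasChristoffel φ D.cov.toFun p Γ) {U : Set (slit n M)}
    (hU : IsOpen U) (hpU : p ∈ U) {X Y : VecField n M} (hX : SmoothFieldOn U X)
    (hY : SmoothFieldOn U Y) {u : Sec n M} (hu : DiffSecAt u p) :
    D.DgWedgeDy g X Y u p =
      metricDerivComp (vertHess (inCoords φ L)) Γ (coords φ p) (dCoords φ p (X p)) (secComp φ u p)
        ((dCoords φ p (Y p)).2 + Γ (dCoords φ p (Y p)).1 (coords φ p).2) -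
      metricDerivComp (vertHess (inCoords φ L)) Γ (coords φ p) (dCoords φ p (Y p)) (secComp φ u p)
        ((dCoords φ p (X p)).2 + Γ (dCoords φ p (X p)).1 (coords φ p).2) := by
  -- Smoothness of the connection enters here: `∇y` must be differentiable to be an argument of the
  -- component formula.
  have hd : ∀ {X : VecField n M}, SmoothFieldOn U X → DiffSecAt (D.nabla X liouville) p :=
    fun hX => ((D.smoothSecOn_nabla hU hX (smoothSecOn_liouville U)).contMDiffAt
      (hU.mem_nhds hpU)).mdifferentiableAt (by simp)
  have h1 := metricDeriv_eq_comp hφ hg hL hp hΓ hu (hd hY) (X p)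
  have h2 := metricDeriv_eq_comp hφ hg hL hp hΓ hu (hd hX) (Y p)
  have h3 : ∀ X : VecField n M, secComp φ (D.nabla X liouville) p =
      (dCoords φ p (X p)).2 + Γ (dCoords φ p (X p)).1 (coords φ p).2 :=
    fun X => hΓ.toComp_liouville hφ hp (X p)
  rw [h3] at h1 h2
  exact congrArg₂ (· - ·) h1 h2

include hφ in
theorem christoffel_eq_chernMap (hD : D.ChernAxioms g) (hg : IsVerticalHessian g L)
    (hL : IsLagrangian L) (hp : p ∈ chartDom φ) (hsymm : ∀ u v, Γ u v = Γ v u)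
    (hΓ : HasChristoffel φ D.cov.toFun p Γ) : Γ = chernMap (inCoords φ L) (coords φ p) := by
  refine (isLocalLagrangian_inCoords hφ hg hL).chernMap_unique (coords_mem_range hφ hp) hsymm ?_
  intro ξ u v
  let z := coords φ p
  -- The first field is horizontal, with `∇_X y = 0`, and the second is vertical, with `∇_Y y = v`.
  -- So (δ) reduces to `(∇_X g)(u, v) = 0`.
  have h1 := hD.almostMetric _ (isOpen_chartDom φ) _ _ _
    (smoothFieldOn_coordField hφ (ξ, -Γ ξ z.2)) (smoothFieldOn_coordField hφ (0, v))
    (smoothSecOn_compSec_const hφ u) p hp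
  rw [dgWedgeDy_eq hφ hg hL hp hΓ (isOpen_chartDom φ) hp
    (smoothFieldOn_coordField hφ (ξ, -Γ ξ z.2)) (smoothFieldOn_coordField hφ (0, v))
    (smoothSecAt_compSec_const hφ hp u).diffSecAt, dCoords_coordField hφ hp,
    dCoords_coordField hφ hp, secComp_compSec hφ hp] at h1
  simp only [metricDerivComp, z, map_zero, LinearMap.zero_apply, add_zero, neg_add_cancel,
    sub_zero] at h1
  linarith

include hφ in
theorem hasChristoffel_chernMap (hD : D.ChernAxioms g) (hg : IsVerticalHessian g L)
    (hL : IsLagrangian L) (hp : p ∈ chartDom φ) :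
    HasChristoffel φ D.cov.toFun p (chernMap (inCoords φ L) (coords φ p)) := by
  obtain ⟨Γ, hsymm, hΓ⟩ := exists_christoffel hφ hD.torsionFree hp
  rwa [← christoffel_eq_chernMap hφ hD hg hL hp hsymm hΓ]

theorem isChern_of_chernAxioms (hD : D.ChernAxioms g) (hg : IsVerticalHessian g L)
    (hL : IsLagrangian L) : D.IsChern L := by
  intro φ hφ p hp b Z
  have hl := isLocalLagrangian_inCoords hφ hg hL
  have hz := coords_mem_range hφ (p := p) hp
  have h1 := hasChristoffel_chernMap hφ hD hg hL (p := p) hp (frame φ b)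
    (smoothSecAt_compSec_const hφ hp (EuclideanSpace.single b 1)).diffSecAt Z
  have h2 := mvfderiv_secComp_compSec_const hφ (p := p) hp (EuclideanSpace.single b 1) Z
  have h3 : secComp φ (frame φ b) p = EuclideanSpace.single b 1 := secComp_compSec hφ hp _
  have h4 : ∀ c, dx φ c p Z = (dCoords φ p Z).1 c :=
    fun c => congrArg (fun w : EuclideanSpace ℝ (Fin n) => w c) (dCoords_fst hφ hp Z).symm
  have h5 : ∀ a, toComp φ p (frame φ a p) = EuclideanSpace.single a 1 :=
    fun a => toComp_ofComp hφ hp _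
  have h6 : chernMap (inCoords φ L) (coords φ p) (dCoords φ p Z).1 (EuclideanSpace.single b 1) =
      ∑ a, (∑ c, chernGamma (inCoords φ L) a b c (coords φ p) * dx φ c p Z) •
        EuclideanSpace.single a (1 : ℝ) := by
    rw [← sum_single (chernMap _ _ _ _)]
    refine Finset.sum_congr rfl fun a _ => congrArg (fun r : ℝ => r • _) ?_
    conv_lhs => rw [← sum_single (dCoords φ p Z).1]
    rw [map_sum, LinearMap.sum_apply, WithLp.ofLp_sum, Finset.sum_apply]
    refine Finset.sum_congr rfl fun c _ => ?_
    rw [map_smul, LinearMap.smul_apply, WithLp.ofLp_smul, Pi.smul_apply, smul_eq_mul,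
      hl.chernMap_single hz, h4, mul_comm]
  apply (toComp_bijective hφ hp).1
  refine h1.trans ?_
  rw [h3, h6]
  refine (congrArg (· + _) h2).trans ((zero_add _).trans ?_)
  rw [map_sum]
  refine Finset.sum_congr rfl fun a _ => ?_
  rw [map_smul, h5]

/-- The Lagrangian `lagrangianOf g` is built from `g` alone, so both connections have the same Chern
coefficients in a chart around each point. -/
theorem same_of_chernAxioms {D' : FinslerConnection n M} (hD : D.ChernAxioms g)
    (hD' : D'.ChernAxioms g) : D.Same D' := by
  intro u p hu
  have hφ := IsManifold.chart_mem_maximalAtlas (I := 𝓡 n) (n := ∞) (p.1.1 : M)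
  have hp : p ∈ chartDom (chartAt (EuclideanSpace ℝ (Fin n)) (p.1.1 : M)) := mem_chart_source _ _
  have hL := isLagrangian_lagrangianOf hD.torsionFree hD.homogeneity
  have hg := isVerticalHessian_lagrangianOf hD.torsionFree hD.homogeneity
  ext1 Z
  apply (toComp_bijective hφ hp).1
  exact (hasChristoffel_chernMap hφ hD hg hL hp u hu Z).trans
    (hasChristoffel_chernMap hφ hD' hg hL hp u hu Z).symm

end FinslerConnection

end

section

open Bundle Filter
open scoped Manifold ContDiff Topology

variable {n : ℕ} {M : Type*} [TopologicalSpace M] [ChartedSpace (EuclideanSpace ℝ (Fin n)) M]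
  [IsManifold (𝓡 n) ∞ M]

variable {φ ψ : OpenPartialHomeomorph M (EuclideanSpace ℝ (Fin n))}
  (hφ : φ ∈ IsManifold.maximalAtlas (𝓡 n) ∞ M) (hψ : ψ ∈ IsManifold.maximalAtlas (𝓡 n) ∞ M)
  {p : slit n M} {g : PullbackMetric n M} {L : TangentBundle (𝓡 n) M → ℝ}

/-! ### Construction of the Chern connection -/

theorem map_add_apply_apply {E F G H : Type*} [AddCommGroup E] [Module ℝ E] [TopologicalSpace E]
    [NormedAddCommGroup F] [NormedSpace ℝ F] [NormedAddCommGroup G] [NormedSpace ℝ G]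
    [NormedAddCommGroup H] [NormedSpace ℝ H] (A : E →L[ℝ] F →L[ℝ] G →L[ℝ] H) (a b : E) (u : F)
    (v : G) : A (a + b) u v = A a u v + A b u v :=
  congrArg (fun f => f u v) (A.map_add a b)

theorem map_zero_apply_apply {E F G H : Type*} [AddCommGroup E] [Module ℝ E] [TopologicalSpace E]
    [NormedAddCommGroup F] [NormedSpace ℝ F] [NormedAddCommGroup G] [NormedSpace ℝ G]
    [NormedAddCommGroup H] [NormedSpace ℝ H] (A : E →L[ℝ] F →L[ℝ] G →L[ℝ] H) (u : F)
    (v : G) : A 0 u v = 0 :=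
  congrArg (fun f => f u v) A.map_zero

namespace IsLocalLagrangian

variable {l : ModelE n → ℝ} {W : Set (ModelE n)} {z : ModelE n}

/-- The Chern connection is horizontally metric. -/
theorem metricDerivComp_chernMap (h : IsLocalLagrangian l W) (hz : z ∈ W) (ζ : ModelE n)
    (u v : EuclideanSpace ℝ (Fin n)) :
    metricDerivComp (vertHess l) (chernMap l z) z ζ u v =
      fderiv ℝ (vertHess l) z (0, ζ.2 + chernMap l z ζ.1 z.2) u v := by
  have h1 := h.chernMap_compatible hz ζ.1 u v
  rw [deltaHess_apply] at h1
  -- Splitting into horizontal and vertical parts. The horizontal derivative of the Hessian is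
  -- absorbed by the two `Γ` terms, and the vertical one is the Cartan term.
  have h2 : ζ = (ζ.1, -barthelMap l z ζ.1) + (0, ζ.2 + barthelMap l z ζ.1) := by
    ext1 <;> simp
  rw [h.chernMap_self hz, metricDerivComp]
  have h3 := (congrArg (fun w => fderiv ℝ (vertHess l) z w u v) h2).trans
    (map_add_apply_apply _ _ _ u v)
  rw [h3, h1]
  ring

end IsLocalLagrangian

include hφ in
theorem isCovariantDerivativeOn_of_hasChristoffel {s : Set (slit n M)}
    {cov : Sec n M → Π p : slit n M, TangentSpace (IE n) p →L[ℝ] PTM n M p}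
    (hs : s ⊆ chartDom φ) (h : ∀ p ∈ s, ∃ Γ, HasChristoffel φ cov p Γ) :
    IsCovariantDerivativeOn (EuclideanSpace ℝ (Fin n)) cov s where
  add {u v p} hu hv hps := by
    obtain ⟨Γ, hΓ⟩ := h p hps
    have hp := hs hps
    ext1 Z
    apply (toComp_bijective hφ hp).1
    refine (hΓ _ (mdifferentiableAt_add_section hu hv) Z).trans
      (Eq.trans ?_ ((map_add (toComp φ p) _ _).trans
        (congrArg₂ (· + ·) (hΓ u hu Z) (hΓ v hv Z))).symm)
    rw [mvfderiv_secComp_add hφ hp hu hv, secComp_add, Pi.add_apply, map_add]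
    abel
  leibniz {u f p} hu hf hps := by
    obtain ⟨Γ, hΓ⟩ := h p hps
    have hp := hs hps
    ext1 Z
    apply (toComp_bijective hφ hp).1
    have h1 : toComp φ p ((f p • cov u p + (mvfderiv (IE n) f p).smulRight (u p)) Z) =
        f p • toComp φ p (cov u p Z) + mvfderiv (IE n) f p Z • secComp φ u p :=
      (map_add (toComp φ p) _ _).trans
        (congrArg₂ (· + ·) (map_smul (toComp φ p) _ _) (map_smul (toComp φ p) _ _))
    refine (hΓ _ (hf.smul_section hu) Z).trans (Eq.trans ?_ h1.symm)
    rw [hΓ u hu, mvfderiv_secComp_smul hφ hp hu hf, secComp_smul, map_smul, smul_add]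
    abel

/-- The Chern connection of `L` over the domain of a chart of `M`. -/
def chartCov (L : TangentBundle (𝓡 n) M → ℝ)
    (φ : OpenPartialHomeomorph M (EuclideanSpace ℝ (Fin n))) (u : Sec n M) (p : slit n M) :
    TangentSpace (IE n) p →L[ℝ] PTM n M p :=
  (ofComp φ p).comp (mvfderiv (IE n) (secComp φ u) p +
    ((LinearMap.toContinuousLinearMap
      ((chernMap (inCoords φ L) (coords φ p)).flip (secComp φ u p))).comp
        (ContinuousLinearMap.fst ℝ _ _)).comp (dCoords φ p))

include hφ in
theorem hasChristoffel_chartCov (hp : p ∈ chartDom φ) :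
    HasChristoffel φ (chartCov L φ) p (chernMap (inCoords φ L) (coords φ p)) :=
  fun _ _ _ => toComp_ofComp hφ hp _

include hφ hψ in
-- Independence of the chart, without any transformation law. The connection built in `ψ` is
-- torsion-free and satisfies `∇_Z g = 0` whenever `∇_Z y = 0`; neither property mentions `ψ`, so
-- `chernMap_unique` in the chart `φ` identifies its coefficients there.
theorem hasChristoffel_chartCov_of_mem (hg : IsVerticalHessian g L) (hL : IsLagrangian L)
    (hp : p ∈ chartDom φ) (hp' : p ∈ chartDom ψ) :
    HasChristoffel φ (chartCov L ψ) p (chernMap (inCoords φ L) (coords φ p)) := by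
  have hlψ := isLocalLagrangian_inCoords hψ hg hL
  have hzψ := coords_mem_range hψ hp'
  have hψΓ := hasChristoffel_chartCov (L := L) hψ hp'
  obtain ⟨Γ, hsymm, hΓ⟩ := exists_christoffel hφ
    (isCovariantDerivativeOn_of_hasChristoffel hψ subset_rfl
      fun q hq => ⟨_, hasChristoffel_chartCov (L := L) hψ hq⟩) hp' hp
    (fun w w' => torsionAt_eq_zero hψ hp' hψΓ (hlψ.chernMap_symm hzψ)
      (smoothFieldAt_coordField hφ hp w) (smoothFieldAt_coordField hφ hp w'))
  convert! hΓ using 1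
  refine ((isLocalLagrangian_inCoords hφ hg hL).chernMap_unique (coords_mem_range hφ hp) hsymm
    fun ξ u v => ?_).symm
  let Z := coordField φ (ξ, -Γ ξ (coords φ p).2) p
  have hu := (smoothSecAt_compSec_const hφ hp u).diffSecAt
  have hv := (smoothSecAt_compSec_const hφ hp v).diffSecAt
  have h1 := FinslerConnection.metricDeriv_eq_comp hφ hg hL hp hΓ hu hv Z
  have h2 := FinslerConnection.metricDeriv_eq_comp hψ hg hL hp' hψΓ hu hv Z
  have h3 := hΓ.toComp_liouville hφ hp Z
  have h4 := hψΓ.toComp_liouville hψ hp' Z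
  have h5 : dCoords φ p Z = (ξ, -Γ ξ (coords φ p).2) := dCoords_coordField hφ hp _
  rw [h5, neg_add_cancel] at h3
  -- The vector `Z` was chosen horizontal for `Γ` in `φ`. The equation `∇_Z y = 0` is intrinsic, so
  -- `Z` is also horizontal in `ψ`, where the Cartan term vanishes.
  have h6 : chartCov L ψ liouville p Z = 0 :=
    (toComp_bijective hφ hp).1 (h3.trans (map_zero _).symm)
  rw [h6, map_zero] at h4
  rw [h1, h5, hlψ.metricDerivComp_chernMap hzψ, ← h4, secComp_compSec hφ hp,
    secComp_compSec hφ hp] at h2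
  have h7 : ((0, 0) : ModelE n) = 0 := rfl
  rw [h7] at h2
  have h8 := h2.trans (map_zero_apply_apply _ _ _)
  rw [metricDerivComp] at h8
  linarith

/-- The Chern connection of `L` as a map on sections. -/
def chernCov (L : TangentBundle (𝓡 n) M → ℝ) (u : Sec n M) (p : slit n M) :
    TangentSpace (IE n) p →L[ℝ] PTM n M p :=
  chartCov L (chartAt (EuclideanSpace ℝ (Fin n)) (p.1.1 : M)) u p

include hφ in
theorem hasChristoffel_chernCov (hg : IsVerticalHessian g L) (hL : IsLagrangian L)
    (hp : p ∈ chartDom φ) :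
    HasChristoffel φ (chernCov L) p (chernMap (inCoords φ L) (coords φ p)) := by
  have hψ := IsManifold.chart_mem_maximalAtlas (I := 𝓡 n) (n := ∞) (p.1.1 : M)
  have hp' : p ∈ chartDom (chartAt (EuclideanSpace ℝ (Fin n)) (p.1.1 : M)) := mem_chart_source _ _
  intro u hu Z
  exact hasChristoffel_chartCov_of_mem hφ hψ hg hL hp hp' u hu Z

theorem isCovariantDerivativeOn_chernCov (hg : IsVerticalHessian g L) (hL : IsLagrangian L) :
    IsCovariantDerivativeOn (EuclideanSpace ℝ (Fin n)) (chernCov (n := n) (M := M) L) := by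
  -- The axioms of a covariant derivative are pointwise here, so each point may use its own chart;
  -- the singletons are then united.
  have key : ∀ p : slit n M, IsCovariantDerivativeOn (EuclideanSpace ℝ (Fin n))
      (chernCov (n := n) (M := M) L) {p} := fun p =>
    isCovariantDerivativeOn_of_hasChristoffel
      (φ := chartAt (EuclideanSpace ℝ (Fin n)) (p.1.1 : M))
      (IsManifold.chart_mem_maximalAtlas _) (by
        rintro _ rfl
        exact mem_chart_source _ _)
      (by
        rintro _ rfl
        exact ⟨_, hasChristoffel_chernCov (IsManifold.chart_mem_maximalAtlas _) hg hL
          (mem_chart_source _ _)⟩)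
  have := IsCovariantDerivativeOn.iUnion key
  rwa [Set.iUnion_of_singleton] at this

theorem IsLocalLagrangian.contMDiffAt_chernMap {l : ModelE n → ℝ} {W : Set (ModelE n)}
    (h : IsLocalLagrangian l W) {c : slit n M → ModelE n} {ξ u : slit n M → EuclideanSpace ℝ (Fin n)}
    (hp : c p ∈ W) (hc : ContMDiffAt (IE n) 𝓘(ℝ, ModelE n) ∞ c p)
    (hξ : ContMDiffAt (IE n) (𝓡 n) ∞ ξ p) (hu : ContMDiffAt (IE n) (𝓡 n) ∞ u p) :
    ContMDiffAt (IE n) (𝓡 n) ∞ (fun q => chernMap l (c q) (ξ q) (u q)) p := by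
  have h1 : ContMDiffAt (IE n)
      𝓘(ℝ, ModelE n × EuclideanSpace ℝ (Fin n) × EuclideanSpace ℝ (Fin n)) ∞
      (fun q => (c q, ξ q, u q)) p :=
    hc.prodMk_space (hξ.prodMk_space hu)
  have h2 : ContDiffAt ℝ ∞ (fun x : ModelE n × EuclideanSpace ℝ (Fin n) ×
      EuclideanSpace ℝ (Fin n) => chernMap l x.1 x.2.1 x.2.2) (c p, ξ p, u p) :=
    h.contDiffOn_chernMap.contDiffAt ((h.isOpen.prod isOpen_univ).mem_nhds ⟨hp, Set.mem_univ _⟩)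
  generalize hF : (fun x : ModelE n × EuclideanSpace ℝ (Fin n) ×
      EuclideanSpace ℝ (Fin n) => chernMap l x.1 x.2.1 x.2.2) = F at h2
  have h3 : (fun q => chernMap l (c q) (ξ q) (u q)) = fun q => F (c q, ξ q, u q) := by
    subst hF
    rfl
  rw [h3]
  exact ContMDiffAt.comp p h2.contMDiffAt h1

theorem exists_chart (p : slit n M) :
    ∃ φ ∈ IsManifold.maximalAtlas (𝓡 n) ∞ M, p ∈ chartDom φ :=
  ⟨_, IsManifold.chart_mem_maximalAtlas (p.1.1 : M), mem_chart_source _ _⟩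

/-- The chart in the definition of `chernCov` varies with the point. By `hasChristoffel_chernCov`
all nearby values have the same expression in one fixed chart, where smoothness is visible; this
requires `u` to be differentiable near `p` and not only at `p`. -/
theorem smoothSecAt_chernCov_apply (hg : IsVerticalHessian g L) (hL : IsLagrangian L)
    {u : Sec n M} (hu : ∀ᶠ q in 𝓝 p, SmoothSecAt u q) {X : VecField n M}
    (hX : SmoothFieldAt X p) : SmoothSecAt (fun q => chernCov L u q (X q)) p := by
  obtain ⟨φ, hφ, hp⟩ := exists_chart p
  rw [smoothSecAt_iff hφ hp]
  have hu' := (smoothSecAt_iff hφ hp).1 hu.self_of_nhds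
  have hdX := contMDiffAt_dCoords_apply hφ hp hX
  have h1 := (isLocalLagrangian_inCoords hφ hg hL).contMDiffAt_chernMap (coords_mem_range hφ hp)
    (contMDiffAt_coords hφ hp)
    ((contDiff_fst.contMDiff.contMDiffAt (x := dCoords φ p (X p))).comp p hdX) hu'
  refine ((contMDiffAt_mvfderiv_apply hu' hX).add h1).congr_of_eventuallyEq ?_
  filter_upwards [(isOpen_chartDom φ).mem_nhds hp, hu] with q hq hq'
  exact hasChristoffel_chernCov hφ hg hL hq u hq'.diffSecAt (X q)

/-- A linear map on a vector space with a basis, recovered from its values on the basis. -/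
theorem contMDiffAt_of_clm_apply {f : slit n M → ModelE n →L[ℝ] EuclideanSpace ℝ (Fin n)}
    (h : ∀ w, ContMDiffAt (IE n) (𝓡 n) ∞ (fun q => f q w) p) :
    ContMDiffAt (IE n) 𝓘(ℝ, ModelE n →L[ℝ] EuclideanSpace ℝ (Fin n)) ∞ f p := by
  let b := Module.finBasis ℝ (ModelE n)
  let c : Fin _ → ModelE n →L[ℝ] ℝ := fun i => LinearMap.toContinuousLinearMap (b.coord i)
  have h1 : f = fun q => ∑ i, ContinuousLinearMap.smulRightL ℝ (ModelE n)
      (EuclideanSpace ℝ (Fin n)) (c i) (f q (b i)) := by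
    funext q
    refine ContinuousLinearMap.ext fun w => ?_
    conv_lhs => rw [← b.sum_repr w, map_sum]
    rw [sum_apply]
    exact Finset.sum_congr rfl fun i _ => map_smul (f q) _ _
  rw [h1]
  refine ContMDiffAt.sum fun i _ => ?_
  exact ((ContinuousLinearMap.smulRightL ℝ (ModelE n) (EuclideanSpace ℝ (Fin n))
    (c i)).contDiff.contMDiff.contMDiffAt (x := f p (b i))).comp p (h (b i))

/-- A section of `Hom(TE, π^*(TM))` is smooth if its values on smooth vector fields are. -/
theorem contMDiffAt_hom_of_apply {A : Π q : slit n M, TangentSpace (IE n) q →L[ℝ] PTM n M q}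
    (h : ∀ X : VecField n M, SmoothFieldAt X p → SmoothSecAt (fun q => A q (X q)) p) :
    ContMDiffAt (IE n) ((IE n).prod 𝓘(ℝ, ModelE n →L[ℝ] EuclideanSpace ℝ (Fin n))) ∞
      (fun q => TotalSpace.mk' (ModelE n →L[ℝ] EuclideanSpace ℝ (Fin n))
        (E := fun q => TangentSpace (IE n) q →L[ℝ] PTM n M q) q (A q)) p := by
  rw [contMDiffAt_hom_bundle]
  refine ⟨contMDiffAt_id, contMDiffAt_of_clm_apply fun w => ?_⟩
  let e := trivializationAt (ModelE n) (TangentSpace (IE n) : slit n M → Type) p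
  let e' := trivializationAt (EuclideanSpace ℝ (Fin n)) (PTM n M) p
  -- The test field is the extension of `w` that is constant in the trivialization at `p`.
  have hX : SmoothFieldAt (fun q => e.symmL ℝ q w) p := by
    refine (Bundle.contMDiffAt_section _).2 ?_
    refine (contMDiffAt_const (c := w)).congr_of_eventuallyEq ?_
    filter_upwards [e.open_baseSet.mem_nhds (FiberBundle.mem_baseSet_trivializationAt' p)]
      with q hq
    exact (e.continuousLinearMapAt_apply_of_mem ℝ hq (e.symmL ℝ q w)).symm.trans
      (e.continuousLinearMapAt_symmL hq w)
  have h1 := (Bundle.contMDiffAt_section _).1 (h _ hX)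
  refine h1.congr_of_eventuallyEq ?_
  filter_upwards [e'.open_baseSet.mem_nhds (FiberBundle.mem_baseSet_trivializationAt' p)] with q hq
  exact e'.continuousLinearMapAt_apply_of_mem ℝ hq _

theorem contMDiffCovariantDerivativeOn_chernCov (hg : IsVerticalHessian g L) (hL : IsLagrangian L)
    {U : Set (slit n M)} (hU : IsOpen U) :
    ContMDiffCovariantDerivativeOn (EuclideanSpace ℝ (Fin n)) ∞ (chernCov L) U where
  contMDiff {u} hu := by
    intro p hp
    have hu' : ∀ q ∈ U, SmoothSecAt u q := fun q hq => hu.contMDiffAt (hU.mem_nhds hq)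
    apply ContMDiffAt.contMDiffWithinAt
    refine contMDiffAt_hom_of_apply fun X hX => smoothSecAt_chernCov_apply hg hL ?_ hX
    filter_upwards [hU.mem_nhds hp] with q hq using hu' q hq

/-- The Chern connection of `L`. -/
def chernConnection (hg : IsVerticalHessian g L) (hL : IsLagrangian L) : FinslerConnection n M where
  cov := ⟨chernCov L, isCovariantDerivativeOn_chernCov hg hL⟩
  smooth _ hU := contMDiffCovariantDerivativeOn_chernCov hg hL hU

/-- By `metricDerivComp_chernMap`, `(∇_Z g)(u, v)` is the Cartan tensor `C(∇_Z y, u, v)`. Since `C`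
annihilates `y`, (γ) holds; since `C` is symmetric, `C(∇_X y, u, ∇_Y y) = C(∇_Y y, u, ∇_X y)`, which
is (δ). -/
theorem chernAxioms_chernConnection (hg : IsVerticalHessian g L) (hL : IsLagrangian L) :
    (chernConnection hg hL).ChernAxioms g where
  regular p Z hZ hZ' := by
    obtain ⟨φ, hφ, hp⟩ := exists_chart p
    have h1 := (hasChristoffel_chernCov hφ hg hL hp).toComp_liouville hφ hp Z
    have h2 : (dCoords φ p Z).1 = 0 := by
      rw [dCoords_fst hφ hp, hZ, map_zero]
    have h3 : chernCov L liouville p Z = 0 := hZ'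
    rw [h2, h3, map_zero, map_zero, LinearMap.zero_apply, add_zero] at h1
    exact (dCoords_bijective hφ hp).1 ((Prod.ext h2 h1.symm).trans (map_zero _).symm)
  torsionFree U hU X Y hX hY p hpU := by
    obtain ⟨φ, hφ, hp⟩ := exists_chart p
    exact torsionAt_eq_zero hφ hp (hasChristoffel_chernCov hφ hg hL hp)
      ((isLocalLagrangian_inCoords hφ hg hL).chernMap_symm (coords_mem_range hφ hp))
      (hX.contMDiffAt (hU.mem_nhds hpU)) (hY.contMDiffAt (hU.mem_nhds hpU))
  homogeneity U hU X v hX hv p hpU := by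
    obtain ⟨φ, hφ, hp⟩ := exists_chart p
    have hl := isLocalLagrangian_inCoords hφ hg hL
    have hz := coords_mem_range hφ hp
    have h1 := FinslerConnection.metricDeriv_eq_comp hφ hg hL hp
      (hasChristoffel_chernCov hφ hg hL hp) (smoothSecAt_liouville p).diffSecAt
      (SmoothSecAt.diffSecAt (hv.contMDiffAt (hU.mem_nhds hpU))) (X p)
    rw [hl.metricDerivComp_chernMap hz] at h1
    exact h1.trans (hl.fderiv_vertHess_vert_self hz _ _)
  almostMetric U hU X Y u hX hY hu p hpU := by
    obtain ⟨φ, hφ, hp⟩ := exists_chart p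
    have hl := isLocalLagrangian_inCoords hφ hg hL
    have hz := coords_mem_range hφ hp
    rw [FinslerConnection.dgWedgeDy_eq hφ hg hL hp (hasChristoffel_chernCov hφ hg hL hp) hU hpU hX
      hY (SmoothSecAt.diffSecAt (hu.contMDiffAt (hU.mem_nhds hpU))),
      hl.metricDerivComp_chernMap hz, hl.metricDerivComp_chernMap hz, sub_eq_zero,
      fderiv_vertHess_symm hl.isOpen hl.contDiffOn hz,
      fderiv_vertHess_vert_symm hl.isOpen hl.contDiffOn hz,
      fderiv_vertHess_symm hl.isOpen hl.contDiffOn hz]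

end

section

open Bundle Filter
open scoped Manifold ContDiff Topology

variable {n : ℕ} {M : Type*} [TopologicalSpace M] [ChartedSpace (EuclideanSpace ℝ (Fin n)) M]
  [IsManifold (𝓡 n) ∞ M]

/-! ### The two forms of the last axiom -/

theorem metricDeriv_symm (cov : Sec n M → Π p : slit n M, TangentSpace (IE n) p →L[ℝ] PTM n M p)
    (g : PullbackMetric n M) (u v : Sec n M) (p : slit n M) (Z : TangentSpace (IE n) p) :
    metricDeriv cov g u v p Z = metricDeriv cov g v u p Z := by
  have h : (fun q => g.toFun q (u q) (v q)) = fun q => g.toFun q (v q) (u q) :=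
    funext fun q => g.symm q (u q) (v q)
  have h1 := g.symm p (cov u p Z) (v p)
  have h2 := g.symm p (u p) (cov v p Z)
  unfold metricDeriv
  exact (congrArg₂ (· - ·) (congrArg₂ (· - ·) (congrArg (fun f => mvfderiv (IE n) f p Z) h) h1)
    h2).trans (sub_right_comm _ _ _)

namespace FinslerConnection

variable {D : FinslerConnection n M} {g : PullbackMetric n M} {U : Set (slit n M)} {p : slit n M}

theorem dg_symm (D : FinslerConnection n M) (g : PullbackMetric n M) (X : VecField n M)
    (u v : Sec n M) (p : slit n M) : D.Dg g X u v p = D.Dg g X v u p :=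
  metricDeriv_symm D.cov.toFun g u v p (X p)

/-- Passes from smooth fields to a single tangent vector, by extending it with constant components.
It then applies to the bracket `[X, Y]` with no discussion of its smoothness. -/
theorem metricDeriv_liouville (hg : D.YDgZero g) (hU : IsOpen U) (hp : p ∈ U) {v : Sec n M}
    (hv : SmoothSecOn U v) (Z : TangentSpace (IE n) p) :
    metricDeriv D.cov.toFun g liouville v p Z = 0 := by
  obtain ⟨φ, hφ, hpφ⟩ := exists_chart p
  have h1 : metricDeriv D.cov.toFun g liouville v p (coordField φ (dCoords φ p Z) p) = 0 :=
    hg (U ∩ chartDom φ) (hU.inter (isOpen_chartDom φ)) _ _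
      ((smoothFieldOn_coordField hφ (dCoords φ p Z)).mono Set.inter_subset_right)
      (hv.mono Set.inter_subset_left) p ⟨hp, hpφ⟩
  have h2 : coordField φ (dCoords φ p Z) p = Z :=
    (dCoords_bijective hφ hpφ).1 (dCoords_coordField hφ hpφ _)
  rwa [h2] at h1

/-- The function `Dg(Y)(y, v)` vanishes near `p`, and so does its derivative. Of the two correction
terms, the one that still contains `y` vanishes too. -/
theorem nablaBilin_dg_liouville (hg : D.YDgZero g) (hU : IsOpen U) (hp : p ∈ U)
    {X Y : VecField n M} {v : Sec n M} (hX : SmoothFieldOn U X) (hv : SmoothSecOn U v) :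
    D.nablaBilin X (D.Dg g Y) liouville v p = -D.Dg g Y v (D.nabla X liouville) p := by
  have h1 : D.Dg g Y liouville v =ᶠ[𝓝 p] fun _ => 0 := by
    filter_upwards [hU.mem_nhds hp] with q hq
    exact metricDeriv_liouville hg hU hq hv (Y q)
  have h2 : mvfderiv (IE n) (D.Dg g Y liouville v) p (X p) = 0 := by
    rw [mvfderiv_congr h1, mvfderiv_const]
    rfl
  have h3 : D.Dg g Y liouville (D.nabla X v) p = 0 :=
    metricDeriv_liouville hg hU hp (D.smoothSecOn_nabla hU hX hv) (Y p)
  rw [nablaBilin, h2, h3, dg_symm]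
  ring

/-- Under (γ), in `D(Dg)(X, Y)(y, v)` only the terms in which `y` itself has been differentiated
remain, and these are `Dg ∧ Dy`. This makes (δ) and (δ') interchangeable. -/
theorem dDg_liouville (hg : D.YDgZero g) (hU : IsOpen U) (hp : p ∈ U)
    {X Y : VecField n M} {v : Sec n M} (hX : SmoothFieldOn U X) (hY : SmoothFieldOn U Y)
    (hv : SmoothSecOn U v) : D.DDg g X Y liouville v p = D.DgWedgeDy g X Y v p := by
  have h1 : D.Dg g (VectorField.mlieBracket (IE n) X Y) liouville v p = 0 :=
    metricDeriv_liouville hg hU hp hv _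
  rw [DDg, extDerivBilin, nablaBilin_dg_liouville hg hU hp hX hv,
    nablaBilin_dg_liouville hg hU hp hY hv, h1, DgWedgeDy]
  ring

theorem chernAxioms'_iff : D.ChernAxioms' g ↔ D.ChernAxioms g := by
  constructor
  · intro h
    refine ⟨h.regular, h.torsionFree, h.homogeneity, fun U hU X Y u hX hY hu p hp => ?_⟩
    rw [← dDg_liouville h.homogeneity hU hp hX hY hu]
    exact h.almostMetric U hU X Y u hX hY hu p hp
  · intro h
    refine ⟨h.regular, h.torsionFree, h.homogeneity, fun U hU X Y u hX hY hu p hp => ?_⟩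
    rw [dDg_liouville h.homogeneity hU hp hX hY hu]
    exact h.almostMetric U hU X Y u hX hY hu p hp

theorem exists_lagrangian (hD : D.ChernAxioms g) :
    ∃ L : TangentBundle (𝓡 n) M → ℝ, IsLagrangian L ∧ IsVerticalHessian g L ∧ D.IsChern L :=
  have hL := isLagrangian_lagrangianOf hD.torsionFree hD.homogeneity
  have hg := isVerticalHessian_lagrangianOf hD.torsionFree hD.homogeneity
  ⟨_, hL, hg, isChern_of_chernAxioms hD hg hL⟩

end FinslerConnection

end

end FinslerGeometry

end

open FinslerGeometry in
open scoped Manifold ContDiff in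
theorem mainTheorem2 (n : ℕ) (M : Type*) [TopologicalSpace M]
    [ChartedSpace (EuclideanSpace ℝ (Fin n)) M] [IsManifold (𝓡 n) ∞ M] (g : PullbackMetric n M) :
    ((∀ D D' : FinslerConnection n M, D.ChernAxioms g → D'.ChernAxioms g → D.Same D') ∧
      (∀ D : FinslerConnection n M, D.ChernAxioms g →
        ∃ L : TangentBundle (𝓡 n) M → ℝ,
          IsLagrangian L ∧ IsVerticalHessian g L ∧ D.IsChern L) ∧
      ((∃ L : TangentBundle (𝓡 n) M → ℝ, IsLagrangian L ∧ IsVerticalHessian g L) →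
        ∃ D : FinslerConnection n M, D.ChernAxioms g)) ∧
    ((∀ D D' : FinslerConnection n M, D.ChernAxioms' g → D'.ChernAxioms' g → D.Same D') ∧
      (∀ D : FinslerConnection n M, D.ChernAxioms' g →
        ∃ L : TangentBundle (𝓡 n) M → ℝ,
          IsLagrangian L ∧ IsVerticalHessian g L ∧ D.IsChern L) ∧
      ((∃ L : TangentBundle (𝓡 n) M → ℝ, IsLagrangian L ∧ IsVerticalHessian g L) →
        ∃ D : FinslerConnection n M, D.ChernAxioms' g)) := by
  simp only [FinslerConnection.chernAxioms'_iff]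
  have h : (∀ D D' : FinslerConnection n M, D.ChernAxioms g → D'.ChernAxioms g → D.Same D') ∧
      (∀ D : FinslerConnection n M, D.ChernAxioms g →
        ∃ L : TangentBundle (𝓡 n) M → ℝ,
          IsLagrangian L ∧ IsVerticalHessian g L ∧ D.IsChern L) ∧
      ((∃ L : TangentBundle (𝓡 n) M → ℝ, IsLagrangian L ∧ IsVerticalHessian g L) →
        ∃ D : FinslerConnection n M, D.ChernAxioms g) :=
    ⟨fun _ _ => FinslerConnection.same_of_chernAxioms, fun _ => FinslerConnection.exists_lagrangian,
      fun ⟨_, hL, hg⟩ => ⟨_, chernAxioms_chernConnection hg hL⟩⟩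
  exact ⟨h, h⟩
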